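/- **Definitions.** A *coarse metric* on a set $M$ is a symmetric map $d:M\times M\to[0,\infty)$ satisfying the triangle inequality. A set $E\subset M\times M$ is *controlled* if $\sup_E d<\infty$; $B\subset M$ is *bounded* if $B\times B$ is controlled; maps $p,q:S\to M$ are *close* if $\sup_s d(p(s),q(s))<\infty$. A *proper coarse metric space* is a set $M$ with a coarse metric and a locally compact Hausdorff topology such that bounded sets have compact closure and there is an open cover $\mathcal U$ of $M$ with $\bigcup_{U\in\mathcal U}U\times U$ controlled. Every proper metric space (closed balls are compact), with its metric and its topology, is one. A map $f:M\to M'$ is *coarse* if for every $R>0$ there is $S>0$ with $d(x,z)\le R\Rightarrow d'(f(x),f(z))\le S$, and preimages of bounded sets are bounded. $M$ and $M'$ are *coarsely equivalent* if there are coarse maps $f:M\to M'$ and $g:M'\to M$ such that $f\circ g$ and $g\circ f$ are close to the identity maps. For a bounded $f:M\to\mathbb C$ and controlled $E$ let $\nabla_Ef(x)=\sup\{|f(x)-f(y)| : (x,y)\in E\}$ (with $\sup\emptyset=0$). A bounded $f$ is a *Higson function* if, for every controlled $E$, $\nabla_Ef$ vanishes at infinity, that is, it is smaller than any given $\varepsilon>0$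 outside some compact set. $\mathcal B_\nu(M)$ is the complex algebra of Borel Higson functions, and $C_\nu(M)$ that of continuous Higson functions, with the supremum norm. The *Higson compactification* $M^\nu$ is the maximal ideal space (the space of characters, with the weak-$*$ topology) of $C_\nu(M)$; $M$ is embedded in it by point evaluations, and the *Higson corona* is $\nu M=M^\nu\setminus M$. Each $f\in\mathcal B_\nu(M)$ has a unique extension to $M^\nu$ that is continuous at the points of $\nu M$; let $\partial f\in C(\nu M)$ be the restriction of this extension to $\nu M$. A homomorphism $\varphi:\mathcal B_\nu(M')\to\mathcal B_\nu(M)$ *induces* $\Phi:C(\nu M')\to C(\nu M)$ if $\Phi(\partial f)=\partial(\varphi(f))$ for all $f\in\mathcal B_\nu(M')$. $M$ is *coarsely quasi-convex* if there are $a,b,c>0$ such that any $x,y\in M$ are joined by a finite sequence $x=x_0,\dots,x_n=y$ with $d(x_{k-1},x_k)\le c$ for all $k$ and $\sum_{k=1}^n d(x_{k-1},x_k)\le a\,d(x,y)+b$. A *net* in $M$ is a subset $A$ for which there is $K>0$ such that each $x\in M$ has some $y\in A$ with $d(x,y)\le K$. $M$ and $M'$ are *coarsely quasi-isometric* if there are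 nets $A\subset M$ and $A'\subset M'$, a bijection $f:A\to A'$ and $C\ge1$ with $\frac1C d(x,y)\le d'(f(x),f(y))\le C\,d(x,y)$ for all $x\ne y$ in $A$. **Theorem.** Let $(M,d)$ and $(M',d')$ be nonempty proper coarse metric spaces (for example, nonempty proper metric spaces). Then $M$ and $M'$ are coarsely equivalent if and only if there is a unital homomorphism of complex algebras $\mathcal B_\nu(M')\to\mathcal B_\nu(M)$ that induces an isomorphism of complex algebras $C(\nu M')\to C(\nu M)$. If moreover $(M,d)$ and $(M',d')$ are both coarsely quasi-convex, then this condition on the algebras is also equivalent to $(M,d)$ and $(M',d')$ being coarsely quasi-isometric. -/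

import Mathlib

open Filter Topology
open scoped BoundedContinuousFunction MeasureTheory

universe u v

noncomputable section

/-- A coarse metric: a symmetric map `d : X × X → [0, ∞)` satisfying the triangle inequality.
Neither `d x x = 0` nor `d x y = 0 → x = y` is required. -/
class CoarseMetric (X : Type u) where
  /-- the coarse distance -/
  cdist : X → X → ℝ
  cdist_nonneg : ∀ x y, 0 ≤ cdist x y
  cdist_comm : ∀ x y, cdist x y = cdist y x
  cdist_triangle : ∀ x y z, cdist x z ≤ cdist x y + cdist y z

namespace CoarseMetric

/-- Every metric is a coarse metric. -/
instance ofMetric (X : Type u) [MetricSpace X] : CoarseMetric X where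
  cdist := dist
  cdist_nonneg _ _ := dist_nonneg
  cdist_comm := dist_comm
  cdist_triangle := dist_triangle

section Coarse

variable {X : Type u} {X' : Type v} [CoarseMetric X] [CoarseMetric X']

/-- Two maps into a coarse metric space are close if they are at finite uniform distance. -/
def Close {S : Type*} (p q : S → X) : Prop :=
  ∃ R : ℝ, ∀ s, cdist (p s) (q s) ≤ R

/-- A set `E ⊆ X × X` is controlled if its two coordinate projections are close. -/
def IsControlled (E : Set (X × X)) : Prop :=
  Close (fun e : E => e.1.1) (fun e : E => e.1.2)

/-- `B` is bounded if `B × B` is controlled. -/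
def IsBdd (B : Set X) : Prop := IsControlled (B ×ˢ B)

/-- A family of subsets is uniformly bounded if the union of all `U × U` is controlled. -/
def IsUniformlyBdd (𝒰 : Set (Set X)) : Prop :=
  IsControlled (⋃ U ∈ 𝒰, U ×ˢ U)

def UniformlyExpansive (f : X → X') : Prop :=
  ∀ R : ℝ, 0 < R → ∃ S : ℝ, 0 < S ∧
    ∀ x z, cdist x z ≤ R → cdist (f x) (f z) ≤ S

def MetricallyProper (f : X → X') : Prop :=
  ∀ B : Set X', IsBdd B → IsBdd (f ⁻¹' B)

def IsCoarseMap (f : X → X') : Prop :=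
  UniformlyExpansive f ∧ MetricallyProper f

variable (X X') in
def CoarselyEquivalent : Prop :=
  ∃ (f : X → X') (g : X' → X), IsCoarseMap f ∧ IsCoarseMap g ∧
    Close (f ∘ g) id ∧ Close (g ∘ f) id

/-- `A` is a net if every point is within a fixed distance of `A`. -/
def IsNet (A : Set X) : Prop :=
  ∃ K : ℝ, 0 < K ∧ ∀ x, ∃ a ∈ A, cdist x a ≤ K

/-- Bi-Lipschitz maps. The condition concerns distinct points, which for metrics is no restriction;
for coarse metrics the numbers `cdist x x` carry no information about the map. -/
def IsBiLipschitzOn {A : Set X} {A' : Set X'} (f : A → A') : Prop :=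
  ∃ C : ℝ, 1 ≤ C ∧ ∀ x y : A, x ≠ y →
    1 / C * cdist (x : X) (y : X) ≤ cdist (f x : X') (f y : X') ∧
    cdist (f x : X') (f y : X') ≤ C * cdist (x : X) (y : X)

variable (X X') in
/-- There is a coarse quasi-isometry: a bi-Lipschitz bijection between nets. -/
def CoarselyQuasiIsometric : Prop :=
  ∃ (A : Set X) (A' : Set X'), IsNet A ∧ IsNet A' ∧
    ∃ f : A → A', Function.Bijective f ∧ IsBiLipschitzOn f

variable (X) in
def CoarselyQuasiConvex : Prop :=
  ∃ a b c : ℝ, 0 < a ∧ 0 < b ∧ 0 < c ∧ ∀ x y : X, ∃ (n : ℕ) (p : ℕ → X),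
    p 0 = x ∧ p n = y ∧ (∀ k < n, cdist (p k) (p (k + 1)) ≤ c) ∧
    ∑ k ∈ Finset.range n, cdist (p k) (p (k + 1)) ≤ a * cdist x y + b

end Coarse

section Expansion

variable {X : Type u}

/-- The `E`-expansion `∇_E f (x) = sup {|f x - f y| : (x, y) ∈ E}` (equal to `0` if there is no such
`y`). It is used for bounded `f` only. -/
def expansion (E : Set (X × X)) (f : X → ℂ) (x : X) : ℝ :=
  ⨆ y : {y : X // (x, y) ∈ E}, ‖f x - f y‖

lemma expansion_nonneg (E : Set (X × X)) (f : X → ℂ) (x : X) : 0 ≤ expansion E f x :=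
  Real.iSup_nonneg fun _ => norm_nonneg _

lemma norm_sub_le_expansion {E : Set (X × X)} {f : X → ℂ} {C : ℝ} (hf : ∀ x, ‖f x‖ ≤ C) {x y : X}
    (h : (x, y) ∈ E) : ‖f x - f y‖ ≤ expansion E f x := by
  refine le_ciSup (f := fun y : {y : X // (x, y) ∈ E} => ‖f x - f y‖) ⟨C + C, ?_⟩ ⟨y, h⟩
  rintro _ ⟨z, rfl⟩
  exact (norm_sub_le _ _).trans (add_le_add (hf _) (hf _))

lemma expansion_le {E : Set (X × X)} {f : X → ℂ} {x : X} {M : ℝ} (hM : 0 ≤ M)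
    (h : ∀ y, (x, y) ∈ E → ‖f x - f y‖ ≤ M) : expansion E f x ≤ M :=
  Real.iSup_le (fun y => h y.1 y.2) hM

end Expansion

end CoarseMetric

open CoarseMetric

/-- Proper coarse metric spaces: the topology is locally compact Hausdorff, there is a uniformly
bounded open cover, and bounded sets have compact closure. -/
class ProperCoarseMetricSpace (X : Type u) [TopologicalSpace X] [CoarseMetric X] : Prop
    extends T2Space X, LocallyCompactSpace X where
  exists_cover : ∃ 𝒰 : Set (Set X), (∀ U ∈ 𝒰, IsOpen U) ∧ ⋃₀ 𝒰 = Set.univ ∧ IsUniformlyBdd 𝒰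
  isCompact_closure : ∀ B : Set X, IsBdd B → IsCompact (closure B)

/-- Proper metric spaces are proper coarse metric spaces. -/
instance ProperCoarseMetricSpace.ofMetric (X : Type u) [MetricSpace X] [ProperSpace X] :
    ProperCoarseMetricSpace X where
  exists_cover := by
    refine ⟨Set.range fun x : X => Metric.ball x 1, ?_, ?_, 2, ?_⟩
    · rintro _ ⟨x, rfl⟩
      exact Metric.isOpen_ball
    · exact Set.eq_univ_of_forall fun x => ⟨_, ⟨x, rfl⟩, Metric.mem_ball_self one_pos⟩
    · rintro ⟨⟨x, y⟩, h⟩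
      simp only [Set.mem_range, Set.iUnion_exists, Set.iUnion_iUnion_eq', Set.mem_iUnion,
        Set.mem_prod, Metric.mem_ball] at h
      obtain ⟨z, hx, hy⟩ := h
      have := dist_triangle_right x y z
      change dist x y ≤ 2
      linarith
  isCompact_closure := by
    rintro B ⟨R, hR⟩
    exact (Metric.isBounded_iff.2
      ⟨R, fun x hx y hy => hR ⟨(x, y), hx, hy⟩⟩).isCompact_closure

section Higson

variable {X : Type u} [TopologicalSpace X] [CoarseMetric X]

def IsBddFun (f : X → ℂ) : Prop := ∃ C : ℝ, ∀ x, ‖f x‖ ≤ C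

/-- The Higson condition on a bounded function: all its expansions along controlled sets vanish at
infinity. -/
def VanishingVariation (f : X → ℂ) : Prop :=
  ∀ E : Set (X × X), IsControlled E → Tendsto (expansion E f) (cocompact X) (𝓝 0)

lemma vanishingVariation_const (c : ℂ) : VanishingVariation (fun _ : X => c) := by
  intro E _
  have : expansion E (fun _ : X => c) = fun _ => 0 := by
    funext x
    exact le_antisymm (expansion_le le_rfl (by simp)) (expansion_nonneg _ _ _)
  rw [this]
  exact tendsto_const_nhds

lemma VanishingVariation.add {f g : X → ℂ} (hf : VanishingVariation f) (hg : VanishingVariation g)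
    (bf : IsBddFun f) (bg : IsBddFun g) : VanishingVariation (f + g) := by
  intro E hE
  obtain ⟨C, hC⟩ := bf
  obtain ⟨D, hD⟩ := bg
  have h0 : Tendsto (fun x => expansion E f x + expansion E g x) (cocompact X) (𝓝 0) := by
    simpa using (hf E hE).add (hg E hE)
  refine squeeze_zero (fun x => expansion_nonneg _ _ _) (fun x => ?_) h0
  refine expansion_le (add_nonneg (expansion_nonneg _ _ _) (expansion_nonneg _ _ _)) fun y hy => ?_
  have e : (f + g) x - (f + g) y = (f x - f y) + (g x - g y) := by
    simp only [Pi.add_apply]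
    ring
  rw [e]
  exact (norm_add_le _ _).trans
    (add_le_add (norm_sub_le_expansion hC hy) (norm_sub_le_expansion hD hy))

lemma VanishingVariation.mul {f g : X → ℂ} (hf : VanishingVariation f) (hg : VanishingVariation g)
    (bf : IsBddFun f) (bg : IsBddFun g) : VanishingVariation (f * g) := by
  intro E hE
  obtain ⟨C, hC⟩ := bf
  obtain ⟨D, hD⟩ := bg
  have h0 : Tendsto (fun x => |C| * expansion E g x + |D| * expansion E f x) (cocompact X)
      (𝓝 0) := by
    simpa using ((hg E hE).const_mul |C|).add ((hf E hE).const_mul |D|)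
  refine squeeze_zero (fun x => expansion_nonneg _ _ _) (fun x => ?_) h0
  have p1 := expansion_nonneg E f x
  have p2 := expansion_nonneg E g x
  refine expansion_le (by positivity) fun y hy => ?_
  have e : (f * g) x - (f * g) y = f x * (g x - g y) + g y * (f x - f y) := by
    simp only [Pi.mul_apply]
    ring
  rw [e]
  refine (norm_add_le _ _).trans ?_
  rw [norm_mul, norm_mul]
  exact add_le_add
    (mul_le_mul ((hC x).trans (le_abs_self C)) (norm_sub_le_expansion hD hy)
      (norm_nonneg _) (abs_nonneg _))
    (mul_le_mul ((hD y).trans (le_abs_self D)) (norm_sub_le_expansion hC hy)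
      (norm_nonneg _) (abs_nonneg _))

variable (X)

/-- The Higson algebra `ℬ_ν(X)` of bounded Borel Higson functions. -/
def BorelHigsonAlgebra : Subalgebra ℂ (X → ℂ) where
  carrier := {f | IsBddFun f ∧ Measurable[borel X] f ∧ VanishingVariation f}
  algebraMap_mem' c := by
    refine ⟨⟨‖c‖, fun x => le_rfl⟩, ?_, vanishingVariation_const c⟩
    let _ := borel X
    exact measurable_const
  add_mem' := by
    rintro f g ⟨⟨C, hC⟩, mf, hf⟩ ⟨⟨D, hD⟩, mg, hg⟩
    refine ⟨⟨C + D, fun x => (norm_add_le _ _).trans (add_le_add (hC x) (hD x))⟩, ?_,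
      hf.add hg ⟨C, hC⟩ ⟨D, hD⟩⟩
    let _ := borel X
    exact mf.add mg
  mul_mem' := by
    rintro f g ⟨⟨C, hC⟩, mf, hf⟩ ⟨⟨D, hD⟩, mg, hg⟩
    refine ⟨⟨C * D, fun x => ?_⟩, ?_, hf.mul hg ⟨C, hC⟩ ⟨D, hD⟩⟩
    · rw [Pi.mul_apply, norm_mul]
      exact mul_le_mul (hC x) (hD x) (norm_nonneg _) ((norm_nonneg _).trans (hC x))
    · let _ := borel X
      exact mf.mul mg

/-- The algebra `C_ν(X)` of bounded continuous Higson functions, with the supremum norm. -/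
def ContHigsonAlgebra : Subalgebra ℂ (X →ᵇ ℂ) where
  carrier := {f | VanishingVariation (f : X → ℂ)}
  algebraMap_mem' c := vanishingVariation_const c
  add_mem' {f g} hf hg := VanishingVariation.add hf hg ⟨‖f‖, f.norm_coe_le_norm⟩ ⟨‖g‖, g.norm_coe_le_norm⟩
  mul_mem' {f g} hf hg := VanishingVariation.mul hf hg ⟨‖f‖, f.norm_coe_le_norm⟩ ⟨‖g‖, g.norm_coe_le_norm⟩

/-- The Higson compactification `X^ν`: the maximal ideal space of `C_ν(X)`. -/
abbrev HigsonCompactification : Type u :=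
  WeakDual.characterSpace ℂ (ContHigsonAlgebra X)

variable {X}

/-- The canonical map `X → X^ν`, sending a point to the evaluation at that point. -/
def toHigson (x : X) : HigsonCompactification X :=
  ⟨{ toFun := fun f => f.1 x
     map_add' := fun _ _ => rfl
     map_smul' := fun _ _ => rfl
     cont := (continuous_eval_const x).comp
       continuous_subtype_val },
   by
    refine ⟨fun h => ?_, fun _ _ => rfl⟩
    have h1 := DFunLike.congr_fun h (1 : ContHigsonAlgebra X)
    exact one_ne_zero h1⟩

variable (X)

/-- The Higson corona `νX = X^ν ∖ X`. -/
abbrev HigsonCorona : Type u :=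
  {p : HigsonCompactification X // p ∉ Set.range (toHigson (X := X))}

variable {X}

/-- `g ∈ C(νX)` is the boundary value of `f : X → ℂ`: there is an extension `F` of `f` to `X^ν` that
is continuous at the points of `νX` and whose restriction to `νX` is `g`. This relation is the
canonical map `ℬ_ν(X) → C(νX)`. -/
def IsBoundaryValue (f : X → ℂ) (g : C(HigsonCorona X, ℂ)) : Prop :=
  ∃ F : HigsonCompactification X → ℂ, (∀ x, F (toHigson x) = f x) ∧
    ∀ p : HigsonCorona X, F p = g p ∧ ContinuousAt F p

end Higson

section Main

variable {X : Type u} {X' : Type v} [TopologicalSpace X] [CoarseMetric X]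
  [TopologicalSpace X'] [CoarseMetric X']

/-- The homomorphism `φ : ℬ_ν(X') → ℬ_ν(X)` induces `Φ : C(νX') → C(νX)`: every `f ∈ ℬ_ν(X')` has
a boundary value, and `Φ` sends it to the boundary value of `φ f`. -/
def Induces (φ : BorelHigsonAlgebra X' →ₐ[ℂ] BorelHigsonAlgebra X)
    (Φ : C(HigsonCorona X', ℂ) →ₐ[ℂ] C(HigsonCorona X, ℂ)) : Prop :=
  ∀ f : BorelHigsonAlgebra X', ∃ g : C(HigsonCorona X', ℂ),
    IsBoundaryValue (f : X' → ℂ) g ∧ IsBoundaryValue (φ f : X → ℂ) (Φ g)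

end Main

end

open CoarseMetric

/-!
Write `ℬ` for the algebra of Borel Higson functions and `ℬ₀` for its ideal of functions vanishing at
infinity. The canonical map `∂ : ℬ(M) → C(νM)` (`boundaryHom`) is surjective with kernel `ℬ₀(M)`
(`surjective_boundaryHom`, `boundaryHom_eq_zero_iff`), so that a homomorphism `φ : ℬ(M') → ℬ(M)`
induces an isomorphism of the corona algebras exactly when it induces an isomorphism
`ℬ(M') / ℬ₀(M') ≅ ℬ(M) / ℬ₀(M)` (`IsCoronaIso`). For the properties of `∂`, a Higson function is
replaced by a continuous one modulo functions vanishing at infinity, and Gelfand duality for the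
C⋆-algebra of continuous Higson functions is applied.

Throughout, a discretization `r : M → M` (`IsDiscretization`), with Borel fibers, bounded
displacement, and finite images of bounded sets, makes arbitrary Higson functions Borel. A coarse
equivalence `f` thus gives the homomorphism `k ↦ k ∘ f ∘ r`, which is an isomorphism modulo `ℬ₀`.

Conversely, let `φ` be an isomorphism modulo `ℬ₀`. The indicators of the fibers of a discretization
of `M'` are idempotents in `ℬ₀(M')`, and a point `x` of `M` where `φ` of the indicator of the fiber
over `y` is `1` satisfies `φ k x = k y` for all `k` constant on the fibers; put `f x = y`. At a point
where there is no such `y`, the character `k ↦ φ k x` vanishes on `ℬ₀(M')`. Such points form a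
bounded set (`IsCoronaIso.isBdd_forall_fiber_ne_one`), by an argument with an uncountable almost
disjoint family of subsets of a sparse sequence. Hence `φ k - k ∘ f` vanishes at infinity for all `k`
(`IsCoronaIso.exists_map`). Testing this against functions that separate asymptotically disjoint sets
(`AsympDisjoint.exists_borelHigson`) shows that `f` is proper and uniformly expansive, that its image
is a net, and that points with nearby images are near each other; so `f` is a coarse equivalence.

On coarsely quasi-convex spaces, uniformly expansive maps grow at most linearly, so that a coarse
equivalence is bi-Lipschitz on a sufficiently sparse separated net; the converse is elementary.
-/

/-! ### Bounded sets and the cocompact filter -/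

section Coarse

variable {M : Type u} [CoarseMetric M]

lemma isControlled_iff {E : Set (M × M)} :
    IsControlled E ↔ ∃ R : ℝ, ∀ x y, (x, y) ∈ E → cdist x y ≤ R :=
  ⟨fun ⟨R, h⟩ => ⟨R, fun x y hxy => h ⟨(x, y), hxy⟩⟩, fun ⟨R, h⟩ => ⟨R, fun e => h _ _ e.2⟩⟩

lemma isBdd_iff_forall {B : Set M} :
    IsBdd B ↔ ∃ R : ℝ, ∀ x ∈ B, ∀ y ∈ B, cdist x y ≤ R := by
  rw [IsBdd, isControlled_iff]
  exact ⟨fun ⟨R, h⟩ => ⟨R, fun x hx y hy => h x y ⟨hx, hy⟩⟩,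
    fun ⟨R, h⟩ => ⟨R, fun x y hxy => h x hxy.1 y hxy.2⟩⟩

lemma isBdd_iff (x₀ : M) {B : Set M} : IsBdd B ↔ ∃ R : ℝ, ∀ x ∈ B, cdist x₀ x ≤ R := by
  rw [isBdd_iff_forall]
  constructor
  · rintro ⟨R, h⟩
    rcases B.eq_empty_or_nonempty with rfl | ⟨b, hb⟩
    · exact ⟨0, by simp⟩
    · exact ⟨cdist x₀ b + R, fun x hx =>
        (cdist_triangle x₀ b x).trans (add_le_add le_rfl (h b hb x hx))⟩
  · rintro ⟨R, h⟩
    refine ⟨R + R, fun x hx y hy => (cdist_triangle x x₀ y).trans (add_le_add ?_ (h y hy))⟩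
    rw [cdist_comm]
    exact h x hx

lemma CoarseMetric.IsBdd.mono {A B : Set M} (hB : IsBdd B) (h : A ⊆ B) : IsBdd A := by
  rw [isBdd_iff_forall] at hB ⊢
  obtain ⟨R, hR⟩ := hB
  exact ⟨R, fun x hx y hy => hR x (h hx) y (h hy)⟩

lemma Set.Finite.isBdd {B : Set M} (hB : B.Finite) : IsBdd B := by
  rcases B.eq_empty_or_nonempty with rfl | ⟨b, -⟩
  · exact isBdd_iff_forall.2 ⟨0, by simp⟩
  · obtain ⟨R, hR⟩ := (hB.image (cdist b)).bddAbove
    exact (isBdd_iff b).2 ⟨R, fun x hx => hR (Set.mem_image_of_mem _ hx)⟩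

lemma CoarseMetric.IsBdd.union {A B : Set M} (hA : IsBdd A) (hB : IsBdd B) : IsBdd (A ∪ B) := by
  rcases A.eq_empty_or_nonempty with rfl | ⟨a, -⟩
  · simpa using hB
  · obtain ⟨R, hR⟩ := (isBdd_iff a).1 hA
    obtain ⟨S, hS⟩ := (isBdd_iff a).1 hB
    refine (isBdd_iff a).2 ⟨max R S, ?_⟩
    rintro x (hx | hx)
    · exact (hR x hx).trans (le_max_left _ _)
    · exact (hS x hx).trans (le_max_right _ _)

lemma CoarseMetric.IsBdd.thickening {B : Set M} (hB : IsBdd B) (R : ℝ) :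
    IsBdd {x | ∃ b ∈ B, cdist b x ≤ R} := by
  rcases B.eq_empty_or_nonempty with rfl | ⟨b, -⟩
  · simpa using hB
  · obtain ⟨S, hS⟩ := (isBdd_iff b).1 hB
    refine (isBdd_iff b).2 ⟨S + R, ?_⟩
    rintro x ⟨y, hy, hx⟩
    exact (cdist_triangle b y x).trans (add_le_add (hS y hy) hx)

lemma CoarseMetric.UniformlyExpansive.image_isBdd {M' : Type v} [CoarseMetric M'] {f : M → M'}
    (hf : UniformlyExpansive f) {B : Set M} (hB : IsBdd B) : IsBdd (f '' B) := by
  obtain ⟨R, hR⟩ := isBdd_iff_forall.1 hB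
  obtain ⟨S, -, hS⟩ := hf (max R 1) (by positivity)
  refine isBdd_iff_forall.2 ⟨S, ?_⟩
  rintro _ ⟨x, hx, rfl⟩ _ ⟨y, hy, rfl⟩
  exact hS x y ((hR x hx y hy).trans (le_max_left _ _))

variable [TopologicalSpace M] [ProperCoarseMetricSpace M]

variable (M) in
/-- The uniformly bounded open cover, in terms of one open neighbourhood of each point. In
particular the numbers `cdist x x` are bounded. -/
lemma exists_open_cdist_le : ∃ R : ℝ, 0 ≤ R ∧ ∀ x : M, ∃ U : Set M, IsOpen U ∧ x ∈ U ∧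
    ∀ y ∈ U, ∀ z ∈ U, cdist y z ≤ R := by
  obtain ⟨𝒰, hopen, hcov, hbdd⟩ := ProperCoarseMetricSpace.exists_cover (X := M)
  obtain ⟨R, hR⟩ := isControlled_iff.1 hbdd
  refine ⟨max R 0, le_max_right _ _, fun x => ?_⟩
  obtain ⟨U, hU, hx⟩ : x ∈ ⋃₀ 𝒰 := by rw [hcov]; trivial
  exact ⟨U, hopen U hU, hx, fun y hy z hz =>
    (hR y z (Set.mem_biUnion hU ⟨hy, hz⟩)).trans (le_max_left _ _)⟩

variable (M) in
lemma exists_cdist_self_le : ∃ R : ℝ, 0 ≤ R ∧ ∀ x : M, cdist x x ≤ R := by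
  obtain ⟨R, hR, h⟩ := exists_open_cdist_le M
  refine ⟨R, hR, fun x => ?_⟩
  obtain ⟨U, -, hx, hU⟩ := h x
  exact hU x hx x hx

lemma IsCompact.isBdd {K : Set M} (hK : IsCompact K) : IsBdd K := by
  obtain ⟨R, -, h⟩ := exists_open_cdist_le M
  refine hK.induction_on (p := IsBdd) Set.finite_empty.isBdd (fun s t hst ht => ht.mono hst)
    (fun s t hs ht => hs.union ht) fun x _ => ?_
  obtain ⟨U, hUo, hx, hU⟩ := h x
  exact ⟨U, mem_nhdsWithin_of_mem_nhds (hUo.mem_nhds hx), isBdd_iff_forall.2 ⟨R, hU⟩⟩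

lemma mem_cocompact_iff_isBdd {s : Set M} : s ∈ cocompact M ↔ IsBdd sᶜ := by
  rw [mem_cocompact]
  constructor
  · rintro ⟨K, hK, h⟩
    exact hK.isBdd.mono (Set.compl_subset_comm.1 h)
  · exact fun h => ⟨closure sᶜ, ProperCoarseMetricSpace.isCompact_closure _ h,
      Set.compl_subset_comm.1 subset_closure⟩

lemma eventually_cocompact_iff {P : M → Prop} :
    (∀ᶠ x in cocompact M, P x) ↔ IsBdd {x | ¬ P x} :=
  mem_cocompact_iff_isBdd

lemma tendsto_cdist_cocompact (x₀ : M) : Tendsto (cdist x₀) (cocompact M) atTop := by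
  refine tendsto_atTop.2 fun R => eventually_cocompact_iff.2 ((isBdd_iff x₀).2 ⟨R, ?_⟩)
  exact fun x hx => (not_le.1 hx).le

lemma tendsto_cocompact_iff_isBdd {S : Type*} {l : Filter S} {p : S → M} :
    Tendsto p l (cocompact M) ↔ ∀ B : Set M, IsBdd B → ∀ᶠ s in l, p s ∉ B := by
  constructor
  · intro h B hB
    exact h (mem_cocompact_iff_isBdd.2 (by simpa using hB) : Bᶜ ∈ cocompact M)
  · intro h s hs
    exact (h _ (mem_cocompact_iff_isBdd.1 hs)).mono fun x hx => not_not.1 hx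

/-- A map at bounded distance from one that tends to infinity tends to infinity. -/
lemma Filter.Tendsto.cocompact_of_cdist_le {S : Type*} {l : Filter S} {p q : S → M}
    (hp : Tendsto p l (cocompact M)) {R : ℝ} (h : ∀ s, cdist (p s) (q s) ≤ R) :
    Tendsto q l (cocompact M) := by
  rw [tendsto_cocompact_iff_isBdd] at hp ⊢
  intro B hB
  filter_upwards [hp _ (hB.thickening R)] with s hs hq
  exact hs ⟨q s, hq, by rw [cdist_comm]; exact h s⟩

lemma CoarseMetric.MetricallyProper.tendsto {M' : Type v} [CoarseMetric M'] [TopologicalSpace M']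
    [ProperCoarseMetricSpace M'] {f : M → M'} (hf : MetricallyProper f) :
    Tendsto f (cocompact M) (cocompact M') :=
  tendsto_cocompact_iff_isBdd.2 fun B hB =>
    eventually_cocompact_iff.2 ((hf B hB).mono fun x hx => by simpa using hx)

lemma metricallyProper_of_tendsto {M' : Type v} [CoarseMetric M'] [TopologicalSpace M']
    [ProperCoarseMetricSpace M'] {f : M → M'} (hf : Tendsto f (cocompact M) (cocompact M')) :
    MetricallyProper f := fun B hB =>
  (eventually_cocompact_iff.1 (tendsto_cocompact_iff_isBdd.1 hf B hB)).mono fun x hx => by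
    simpa using hx

variable (M) in
lemma sigmaCompactSpace_of_proper : SigmaCompactSpace M := by
  rcases isEmpty_or_nonempty M with h | ⟨⟨x₀⟩⟩
  · exact inferInstance
  refine ⟨⟨fun n => closure {x | cdist x₀ x ≤ n}, fun n =>
    ProperCoarseMetricSpace.isCompact_closure _ ((isBdd_iff x₀).2 ⟨n, fun x hx => hx⟩), ?_⟩⟩
  refine Set.eq_univ_of_forall fun x => ?_
  obtain ⟨n, hn⟩ := exists_nat_ge (cdist x₀ x)
  exact Set.mem_iUnion.2 ⟨n, subset_closure hn⟩

/-! ### Discretization -/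

/-- A map of `M` to itself that moves points by a bounded amount, has all its preimages Borel, and
sends bounded sets to finite sets. Composition with it makes arbitrary functions Borel. -/
structure IsDiscretization (r : M → M) : Prop where
  measurableSet_preimage : ∀ s : Set M, MeasurableSet[borel M] (r ⁻¹' s)
  exists_cdist_le : ∃ R : ℝ, ∀ x, cdist (r x) x ≤ R
  finite_image : ∀ B : Set M, IsBdd B → (r '' B).Finite

variable (M) in
lemma exists_isDiscretization [Nonempty M] : ∃ r : M → M, IsDiscretization r := by
  classical
  have := sigmaCompactSpace_of_proper M
  obtain ⟨R, -, h⟩ := exists_open_cdist_le M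
  choose U hUo hxU hU using h
  obtain ⟨s, hs, hcov⟩ := countable_cover_nhds_of_sigmaCompact fun x => (hUo x).mem_nhds (hxU x)
  have hne : s.Nonempty := by
    by_contra hne
    rw [Set.not_nonempty_iff_eq_empty] at hne
    subst hne
    simp only [Set.mem_empty_iff_false, Set.iUnion_of_empty, Set.iUnion_empty] at hcov
    exact Set.empty_ne_univ hcov
  obtain ⟨c, rfl⟩ := hs.exists_eq_range hne
  have hc : ∀ x, ∃ n, x ∈ U (c n) := fun x => by
    have : x ∈ ⋃ y ∈ Set.range c, U y := by rw [hcov]; trivial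
    simpa using this
  -- each point goes to the centre of the first member of a countable cover that contains it
  refine ⟨fun x => c (Nat.find (hc x)), fun t => ?_, ⟨R, fun x => ?_⟩, fun B hB => ?_⟩
  · let _ := borel M
    have : BorelSpace M := ⟨rfl⟩
    have hm : Measurable fun x => Nat.find (hc x) :=
      measurable_find _ fun n => (hUo (c n)).measurableSet
    exact hm (t := c ⁻¹' t) trivial
  · exact hU _ _ (hxU _) _ (Nat.find_spec (hc x))
  · have hK := ProperCoarseMetricSpace.isCompact_closure B hB
    obtain ⟨t, ht⟩ := hK.elim_finite_subcover (fun n => U (c n)) (fun n => hUo _)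
      fun x _ => Set.mem_iUnion.2 (hc x)
    obtain ⟨N, hN⟩ := t.bddAbove
    refine ((Set.finite_Iic N).image c).subset ?_
    rintro _ ⟨x, hx, rfl⟩
    obtain ⟨n, hn, hxn⟩ := Set.mem_iUnion₂.1 (ht (subset_closure hx))
    exact ⟨_, (Nat.find_min' (hc x) hxn).trans (hN hn), rfl⟩

lemma IsDiscretization.tendsto {r : M → M} (hr : IsDiscretization r) :
    Tendsto r (cocompact M) (cocompact M) := by
  obtain ⟨R, hR⟩ := hr.exists_cdist_le
  exact tendsto_id.cocompact_of_cdist_le (R := R) fun x => by rw [cdist_comm]; exact hR x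

end Coarse

/-! ### Higson functions -/

section Higson

variable {M : Type u} [TopologicalSpace M] [CoarseMetric M]

lemma VanishingVariation.of_eventually {f : M → ℂ}
    (h : ∀ R ε : ℝ, 0 < ε → ∀ᶠ x in cocompact M, ∀ y, cdist x y ≤ R → ‖f x - f y‖ ≤ ε) :
    VanishingVariation f := by
  intro E hE
  obtain ⟨R, hR⟩ := isControlled_iff.1 hE
  rw [Metric.tendsto_nhds]
  intro ε hε
  filter_upwards [h R (ε / 2) (by positivity)] with x hx
  rw [Real.dist_0_eq_abs, abs_of_nonneg (expansion_nonneg _ _ _)]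
  exact (expansion_le (by positivity) fun y hy => hx y (hR x y hy)).trans_lt (by linarith)

/-- A Higson function has asymptotically equal values along maps at bounded distance. -/
lemma VanishingVariation.tendsto_sub {f : M → ℂ} (hf : VanishingVariation f) (bf : IsBddFun f)
    {S : Type*} {l : Filter S} {p q : S → M} (hp : Tendsto p l (cocompact M)) {R : ℝ}
    (h : ∀ s, cdist (p s) (q s) ≤ R) : Tendsto (fun s => f (p s) - f (q s)) l (𝓝 0) := by
  obtain ⟨C, hC⟩ := bf
  have hE : IsControlled {e : M × M | cdist e.1 e.2 ≤ R} := isControlled_iff.2 ⟨R, fun x y h => h⟩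
  exact squeeze_zero_norm (fun s => norm_sub_le_expansion hC (h s)) ((hf _ hE).comp hp)

lemma VanishingVariation.eventually {f : M → ℂ} (hf : VanishingVariation f) (bf : IsBddFun f)
    (R : ℝ) {ε : ℝ} (hε : 0 < ε) : ∀ᶠ x in cocompact M, ∀ y, cdist x y ≤ R → ‖f x - f y‖ ≤ ε := by
  obtain ⟨C, hC⟩ := bf
  have hE : IsControlled {e : M × M | cdist e.1 e.2 ≤ R} := isControlled_iff.2 ⟨R, fun x y h => h⟩
  filter_upwards [(hf _ hE).eventually_le_const hε] with x hx y hy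
  exact (norm_sub_le_expansion (E := {e : M × M | cdist e.1 e.2 ≤ R}) hC hy).trans hx

lemma VanishingVariation.comp {M' : Type v} [TopologicalSpace M'] [CoarseMetric M'] {g : M' → ℂ}
    (hg : VanishingVariation g) (bg : IsBddFun g) {f : M → M'} (hf : UniformlyExpansive f)
    (ht : Tendsto f (cocompact M) (cocompact M')) : VanishingVariation (g ∘ f) := by
  refine .of_eventually fun R ε hε => ?_
  obtain ⟨S, -, hS⟩ := hf (max R 1) (by positivity)
  filter_upwards [ht.eventually (hg.eventually bg S hε)] with x hx y hy
  exact hx _ (hS x y (hy.trans (le_max_left _ _)))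

lemma VanishingVariation.of_tendsto_zero [ProperCoarseMetricSpace M] {f : M → ℂ}
    (hf : Tendsto f (cocompact M) (𝓝 0)) : VanishingVariation f := by
  refine .of_eventually fun R ε hε => ?_
  have h1 : ∀ᶠ x in cocompact M, ‖f x‖ ≤ ε / 2 :=
    (tendsto_zero_iff_norm_tendsto_zero.1 hf).eventually_le_const (by positivity)
  have h2 := (eventually_cocompact_iff.1 h1).thickening R
  have h3 : ∀ᶠ x in cocompact M, ¬ ∃ y, (¬ ‖f y‖ ≤ ε / 2) ∧ cdist y x ≤ R :=
    eventually_cocompact_iff.2 (by simpa only [not_not, Set.mem_ofPred_eq] using h2)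
  filter_upwards [h1, h3] with x hx hx' y hy
  have : ‖f y‖ ≤ ε / 2 := by
    by_contra hcon
    exact hx' ⟨y, hcon, by rw [cdist_comm]; exact hy⟩
  exact (norm_sub_le _ _).trans (by linarith)

end Higson

/-! ### Coarse equivalences and quasi-isometries -/

section QuasiIsometry

variable {M : Type u} {M' : Type v} [CoarseMetric M] [CoarseMetric M']

lemma CoarseMetric.UniformlyExpansive.metricallyProper {f : M → M'} {g : M' → M}
    (hg : UniformlyExpansive g) (h : Close (g ∘ f) id) : MetricallyProper f := by
  intro B hB
  obtain ⟨R, hR⟩ := h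
  refine ((hg.image_isBdd hB).thickening R).mono fun x hx => ?_
  exact ⟨g (f x), Set.mem_image_of_mem g hx, hR x⟩

lemma coarselyEquivalent_of_uniformlyExpansive {f : M → M'} {g : M' → M}
    (hf : UniformlyExpansive f) (hg : UniformlyExpansive g) (hfg : Close (f ∘ g) id)
    (hgf : Close (g ∘ f) id) : CoarselyEquivalent M M' :=
  ⟨f, g, ⟨hf, hg.metricallyProper hgf⟩, ⟨hg, hf.metricallyProper hfg⟩, hfg, hgf⟩

lemma uniformlyExpansive_of_le_mul {A : Set M} {A' : Set M'} {f : A → A'} {C R₀ K : ℝ}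
    (hC : 0 ≤ C) (h₀ : ∀ y : M', cdist y y ≤ R₀)
    (hf : ∀ x y : A, x ≠ y → cdist (f x : M') (f y) ≤ C * cdist (x : M) y)
    {a : M → A} (ha : ∀ x, cdist x (a x : M) ≤ K) :
    UniformlyExpansive fun x => (f (a x) : M') := by
  intro R hR
  refine ⟨max 1 (max R₀ (C * (K + R + K))), by positivity, fun x z hxz => ?_⟩
  refine le_trans ?_ (le_max_right _ _)
  by_cases h : a x = a z
  · simp only [h]
    exact (h₀ _).trans (le_max_left _ _)
  · refine ((hf _ _ h).trans (mul_le_mul_of_nonneg_left ?_ hC)).trans (le_max_right _ _)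
    have h1 := cdist_triangle (a x : M) x (a z)
    have h2 := cdist_triangle x z (a z : M)
    have h3 := ha x
    rw [cdist_comm] at h3
    linarith [ha z]

lemma close_of_le_mul {A : Set M} {A' : Set M'} (e : A ≃ A') {C R₀ K K' : ℝ} (hC : 0 ≤ C)
    (h₀ : ∀ x : M, cdist x x ≤ R₀)
    (he : ∀ x y : A, x ≠ y → cdist (x : M) y ≤ C * cdist (e x : M') (e y))
    {a : M → A} (ha : ∀ x, cdist x (a x : M) ≤ K)
    {a' : M' → A'} (ha' : ∀ x, cdist x (a' x : M') ≤ K') :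
    Close ((fun y => (e.symm (a' y) : M)) ∘ fun x => (e (a x) : M')) id := by
  refine ⟨max R₀ (C * K') + K, fun x => ?_⟩
  set p := e.symm (a' (e (a x)))
  refine (cdist_triangle (p : M) (a x) x).trans (add_le_add ?_ ?_)
  · by_cases h : p = a x
    · rw [h]
      exact (h₀ _).trans (le_max_left _ _)
    · refine ((he _ _ h).trans (mul_le_mul_of_nonneg_left ?_ hC)).trans (le_max_right _ _)
      rw [Equiv.apply_symm_apply, cdist_comm]
      exact ha' _
  · rw [cdist_comm]
    exact ha x

variable [TopologicalSpace M] [ProperCoarseMetricSpace M]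
  [TopologicalSpace M'] [ProperCoarseMetricSpace M']

lemma CoarseMetric.CoarselyQuasiIsometric.coarselyEquivalent (h : CoarselyQuasiIsometric M M') :
    CoarselyEquivalent M M' := by
  obtain ⟨A, A', ⟨K, -, hK⟩, ⟨K', -, hK'⟩, f, hf, C, hC, hfC⟩ := h
  obtain ⟨R₀, -, hR₀⟩ := exists_cdist_self_le M
  obtain ⟨R₀', -, hR₀'⟩ := exists_cdist_self_le M'
  have hC0 : 0 ≤ C := by linarith
  have hlow : ∀ x y : A, x ≠ y → cdist (x : M) y ≤ C * cdist (f x : M') (f y) := fun x y hxy => by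
    have := (hfC x y hxy).1
    rwa [one_div, inv_mul_le_iff₀ (by linarith)] at this
  choose a haA ha using hK
  choose a' haA' ha' using hK'
  set e : A ≃ A' := Equiv.ofBijective f hf
  have hlow' : ∀ x y : A', x ≠ y →
      cdist (e.symm x : M) (e.symm y) ≤ C * cdist (x : M') (y : M') := fun x y hxy => by
    have := hlow (e.symm x) (e.symm y) (e.symm.injective.ne hxy)
    change _ ≤ C * cdist (e (e.symm x) : M') (e (e.symm y)) at this
    simpa using this
  have hup' : ∀ x y : A', x ≠ y →
      cdist (x : M') (y : M') ≤ C * cdist (e.symm x : M) (e.symm y) := fun x y hxy => by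
    have : cdist (e (e.symm x) : M') (e (e.symm y)) ≤ _ :=
      (hfC (e.symm x) (e.symm y) (e.symm.injective.ne hxy)).2
    simpa using this
  exact coarselyEquivalent_of_uniformlyExpansive
    (uniformlyExpansive_of_le_mul (f := e) (a := fun x => ⟨a x, haA x⟩) hC0 hR₀'
      (fun x y h => (hfC x y h).2) ha)
    (uniformlyExpansive_of_le_mul (f := e.symm) (a := fun x => ⟨a' x, haA' x⟩) hC0 hR₀ hlow' ha')
    (close_of_le_mul e.symm (a := fun x => ⟨a' x, haA' x⟩) (a' := fun x => ⟨a x, haA x⟩)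
      hC0 hR₀' hup' ha' ha)
    (close_of_le_mul e (a := fun x => ⟨a x, haA x⟩) (a' := fun x => ⟨a' x, haA' x⟩)
      hC0 hR₀ hlow ha ha')

/-- On a coarsely quasi-convex space, uniformly expansive maps grow at most linearly: a chain from
`x` to `y` is cut into pieces of length about `c`, whose number is linear in `cdist x y`. -/
lemma CoarseMetric.UniformlyExpansive.exists_le_mul_add (hM : CoarselyQuasiConvex M) {f : M → M'}
    (hf : UniformlyExpansive f) :
    ∃ L : ℝ, 0 < L ∧ ∀ x y, cdist (f x) (f y) ≤ L * cdist x y + L := by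
  obtain ⟨a, b, c, ha, hb, hc, hch⟩ := hM
  obtain ⟨R₀, hR₀, h₀⟩ := exists_cdist_self_le M
  obtain ⟨R₀', hR₀', h₀'⟩ := exists_cdist_self_le M'
  obtain ⟨S, hS, hfS⟩ := hf (c + c + R₀) (by positivity)
  -- `q` is the last division point, `m` the number of pieces before it, `t` the length after it
  have key : ∀ (p : ℕ → M) (n : ℕ), (∀ k < n, cdist (p k) (p (k + 1)) ≤ c) →
      ∃ (q : M) (m : ℕ) (t : ℝ), 0 ≤ t ∧ t ≤ c ∧ cdist q (p n) ≤ t + R₀ ∧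
        m * c + t ≤ ∑ k ∈ Finset.range n, cdist (p k) (p (k + 1)) ∧
        cdist (f (p 0)) (f q) ≤ R₀' + m * S := by
    intro p n
    induction n with
    | zero =>
      intro _
      refine ⟨p 0, 0, 0, le_rfl, hc.le, by simpa using h₀ _, by simp, by simpa using h₀' _⟩
    | succ n ih =>
      intro hp
      obtain ⟨q, m, t, ht, htc, hq, hm, hfq⟩ := ih fun k hk => hp k (hk.trans n.lt_succ_self)
      have hs := hp n n.lt_succ_self
      have hs0 := cdist_nonneg (p n) (p (n + 1))
      have htri := cdist_triangle q (p n) (p (n + 1))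
      rw [Finset.sum_range_succ]
      by_cases h : t + cdist (p n) (p (n + 1)) ≤ c
      · exact ⟨q, m, _, add_nonneg ht hs0, h, by linarith, by linarith, hfq⟩
      · refine ⟨p (n + 1), m + 1, 0, le_rfl, hc.le, by simpa using h₀ _, ?_, ?_⟩
        · push_cast
          linarith
        · have h1 := hfS q (p (n + 1)) (by linarith)
          have h2 := cdist_triangle (f (p 0)) (f q) (f (p (n + 1)))
          push_cast
          linarith
  refine ⟨max (S * a / c) (R₀' + S * b / c + S), by positivity, fun x y => ?_⟩
  obtain ⟨n, p, rfl, rfl, hpc, hsum⟩ := hch x y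
  obtain ⟨q, m, t, ht, htc, hq, hm, hfq⟩ := key p n hpc
  have hm' : (m : ℝ) ≤ (a * cdist (p 0) (p n) + b) / c := by
    rw [le_div_iff₀ hc]
    linarith
  have h1 := hfS q (p n) (by linarith)
  have h2 := cdist_triangle (f (p 0)) (f q) (f (p n))
  have h3 := mul_le_mul_of_nonneg_right hm' hS.le
  calc cdist (f (p 0)) (f (p n))
      ≤ R₀' + (a * cdist (p 0) (p n) + b) / c * S + S := by linarith
    _ = S * a / c * cdist (p 0) (p n) + (R₀' + S * b / c + S) := by ring
    _ ≤ _ := add_le_add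
      (mul_le_mul_of_nonneg_right (le_max_left _ _) (cdist_nonneg _ _)) (le_max_right _ _)


variable (M) in
lemma exists_separated_isNet (δ : ℝ) : ∃ A : Set M,
    (∀ x ∈ A, ∀ y ∈ A, x ≠ y → δ < cdist x y) ∧ IsNet A := by
  obtain ⟨R₀, hR₀, h₀⟩ := exists_cdist_self_le M
  obtain ⟨A, hA⟩ := zorn_subset {A : Set M | ∀ x ∈ A, ∀ y ∈ A, x ≠ y → δ < cdist x y} <| by
    intro c hc hchain
    refine ⟨⋃₀ c, ?_, fun s hs => Set.subset_sUnion_of_mem hs⟩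
    rintro x ⟨s, hs, hx⟩ y ⟨t, ht, hy⟩ hxy
    rcases hchain.total hs ht with h | h
    · exact hc ht x (h hx) y hy hxy
    · exact hc hs x hx y (h hy) hxy
  refine ⟨A, hA.prop, max 1 (max δ R₀), by positivity, fun x => ?_⟩
  by_contra! hcon
  have hx : x ∉ A := fun hx => by
    have := hcon x hx
    have := h₀ x
    have := le_max_right δ R₀
    have := le_max_right 1 (max δ R₀)
    linarith
  have hδ : ∀ y ∈ A, δ < cdist x y := fun y hy =>
    ((le_max_left _ _).trans (le_max_right _ _)).trans_lt (hcon y hy)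
  refine hx (hA.le_of_ge (y := insert x A) ?_ (Set.subset_insert x A) (Set.mem_insert x A))
  rintro y (rfl | hy) z (rfl | hz) hyz
  · exact absurd rfl hyz
  · exact hδ z hz
  · rw [cdist_comm]
    exact hδ y hy
  · exact hA.prop y hy z hz hyz

lemma CoarseMetric.CoarselyEquivalent.coarselyQuasiIsometric (hM : CoarselyQuasiConvex M)
    (hM' : CoarselyQuasiConvex M') (h : CoarselyEquivalent M M') :
    CoarselyQuasiIsometric M M' := by
  obtain ⟨f, g, hf, hg, ⟨T', hT'⟩, T, hT⟩ := h
  obtain ⟨L, hL, hfL⟩ := hf.1.exists_le_mul_add hM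
  obtain ⟨P, hP, hgP⟩ := hg.1.exists_le_mul_add hM'
  obtain ⟨R₀', hR₀', h₀'⟩ := exists_cdist_self_le M'
  -- `f` shrinks distances at most affinely, since `g` expands them at most affinely
  have hlow : ∀ x y, cdist x y ≤ P * cdist (f x) (f y) + (P + 2 * |T|) := fun x y => by
    have h1 := cdist_triangle x (g (f x)) y
    have h2 := cdist_triangle (g (f x)) (g (f y)) y
    have h3 : cdist (g (f x)) x ≤ T := hT x
    have h4 : cdist (g (f y)) y ≤ T := hT y
    rw [cdist_comm] at h3
    have h5 := hgP (f x) (f y)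
    have h6 := le_abs_self T
    linarith
  -- on a `δ`-separated net with `δ` large, the additive constants are absorbed
  set δ : ℝ := 2 * (P + 2 * |T|) + 2 * P * R₀' + 1 with hδ
  have hT0 := abs_nonneg T
  have hPR : 0 ≤ P * R₀' := by positivity
  obtain ⟨A, hsep, K, hK, hnet⟩ := exists_separated_isNet M δ
  have hlow' : ∀ x ∈ A, ∀ y ∈ A, x ≠ y → cdist x y ≤ 2 * P * cdist (f x) (f y) ∧
      R₀' < cdist (f x) (f y) := fun x hx y hy hxy => by
    have h1 := hlow x y
    have h2 := hsep x hx y hy hxy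
    have h3 : cdist x y ≤ 2 * P * cdist (f x) (f y) := by linarith
    refine ⟨h3, ?_⟩
    by_contra! hcon
    have h4 := mul_le_mul_of_nonneg_left hcon hP.le
    linarith
  have hinj : Set.InjOn f A := fun x hx y hy hxy => by
    by_contra hne
    have := (hlow' x hx y hy hne).2
    rw [hxy] at this
    exact absurd (h₀' _) (not_le.2 this)
  obtain ⟨S, hS, hfS⟩ := hf.1 K hK
  refine ⟨A, f '' A, ⟨K, hK, hnet⟩, ⟨|T'| + S, by positivity, fun y => ?_⟩,
    fun x => ⟨f x, Set.mem_image_of_mem f x.2⟩, ⟨fun x y hxy => ?_, ?_⟩,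
    max (2 * P) (2 * L + 1), ?_, ?_⟩
  · obtain ⟨a, ha, hga⟩ := hnet (g y)
    refine ⟨f a, Set.mem_image_of_mem f ha, ?_⟩
    have h1 : cdist (f (g y)) y ≤ T' := hT' y
    have h2 := hfS _ _ hga
    have h3 := cdist_triangle y (f (g y)) (f a)
    rw [cdist_comm] at h1
    have := le_abs_self T'
    linarith
  · exact Subtype.ext (hinj x.2 y.2 (congrArg Subtype.val hxy))
  · rintro ⟨_, x, hx, rfl⟩
    exact ⟨⟨x, hx⟩, rfl⟩
  · exact le_trans (by linarith) (le_max_right _ _)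
  · intro x y hxy
    have hne : (x : M) ≠ y := fun h => hxy (Subtype.ext h)
    have h1 := hlow' x x.2 y y.2 hne
    have h2 := hsep x x.2 y y.2 hne
    have h3 := hfL x y
    have h4 := cdist_nonneg (f x) (f y)
    constructor
    · rw [one_div, inv_mul_le_iff₀ (by positivity)]
      exact h1.1.trans (mul_le_mul_of_nonneg_right (le_max_left _ _) h4)
    · have h5 : (1 : ℝ) ≤ cdist (x : M) y := by linarith
      refine le_trans ?_ (mul_le_mul_of_nonneg_right (le_max_right _ _) (by linarith))
      change cdist (f x) (f y) ≤ _
      nlinarith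

end QuasiIsometry

/-! ### The Higson compactification and boundary values -/

section Corona

variable {M : Type u} [TopologicalSpace M] [CoarseMetric M]

variable (M) in
lemma isClosed_contHigsonAlgebra : IsClosed (ContHigsonAlgebra M : Set (M →ᵇ ℂ)) := by
  refine isClosed_of_closure_subset fun f hf => VanishingVariation.of_eventually fun R ε hε => ?_
  obtain ⟨g, hg, hfg⟩ := Metric.mem_closure_iff.1 hf (ε / 3) (by positivity)
  have hg' : VanishingVariation (g : M → ℂ) := hg
  filter_upwards [hg'.eventually ⟨‖g‖, g.norm_coe_le_norm⟩ R (ε := ε / 3) (by positivity)]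
    with x hx y hy
  have h1 := (BoundedContinuousFunction.dist_coe_le_dist (f := f) (g := g) x).trans hfg.le
  have h2 := (BoundedContinuousFunction.dist_coe_le_dist (f := f) (g := g) y).trans hfg.le
  have h3 := hx y hy
  rw [← dist_eq_norm] at h3 ⊢
  have h4 := dist_triangle4 (f x) (g x) (g y) (f y)
  rw [dist_comm (g y)] at h4
  linarith

/-- The algebra of continuous Higson functions is a commutative C⋆-algebra, with pointwise complex
conjugation as its involution. -/
noncomputable instance ContHigsonAlgebra.commCStarAlgebra :
    CommCStarAlgebra (ContHigsonAlgebra M) where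
  star f := ⟨star f.1, by
    have hf : VanishingVariation (f.1 : M → ℂ) := f.2
    refine VanishingVariation.of_eventually fun R ε hε => ?_
    filter_upwards [hf.eventually ⟨‖f.1‖, f.1.norm_coe_le_norm⟩ R hε] with x hx y hy
    have := hx y hy
    rwa [← norm_star, star_sub] at this⟩
  star_involutive f := Subtype.ext (star_star f.1)
  star_mul f g := Subtype.ext (star_mul f.1 g.1)
  star_add f g := Subtype.ext (star_add f.1 g.1)
  star_smul c f := Subtype.ext (star_smul c f.1)
  norm_mul_self_le f := (CStarRing.norm_star_mul_self (x := f.1)).symm.le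
  toCompleteSpace := (isClosed_contHigsonAlgebra M).completeSpace_coe

lemma exists_contHigsonAlgebra_eq (F : C(HigsonCompactification M, ℂ)) :
    ∃ f : ContHigsonAlgebra M, ∀ p : HigsonCompactification M, p f = F p := by
  obtain ⟨f, hf⟩ := (gelfandTransform_bijective (ContHigsonAlgebra M)).2 F
  exact ⟨f, fun p => DFunLike.congr_fun hf p⟩

lemma continuous_eval_higson (f : ContHigsonAlgebra M) :
    Continuous fun p : HigsonCompactification M => p f :=
  (WeakDual.gelfandTransform ℂ (ContHigsonAlgebra M) f).continuous

lemma continuous_toHigson : Continuous (toHigson (X := M)) :=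
  continuous_induced_rng.2 (WeakDual.continuous_of_continuous_eval fun f => f.1.continuous)

variable (M) in
lemma denseRange_toHigson : DenseRange (toHigson (X := M)) := by
  intro p
  by_contra hp
  obtain ⟨F, hF1, hF0, -, -⟩ := exists_continuous_one_zero_of_isCompact
    (isCompact_singleton (x := p)) isClosed_closure (Set.disjoint_singleton_left.2 hp)
  obtain ⟨f, hf⟩ := exists_contHigsonAlgebra_eq
    (⟨fun p => (F p : ℂ), Complex.continuous_ofReal.comp F.continuous⟩ : C(_, ℂ))
  have hf0 : f = 0 := by
    refine Subtype.ext (BoundedContinuousFunction.ext fun x => ?_)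
    have h1 : f.1 x = (F (toHigson x) : ℂ) := hf (toHigson x)
    have h2 : F (toHigson x) = 0 := hF0 (subset_closure (Set.mem_range_self x))
    rw [h1, h2]
    rfl
  have h1 : p f = (F p : ℂ) := hf p
  rw [hf0, map_zero, hF1 (Set.mem_singleton p)] at h1
  simp at h1

-- Stated for an abstract algebra, where the instance is found quickly.
lemma compactSpace_characterSpace (A : Type*) [CommCStarAlgebra A] :
    CompactSpace (WeakDual.characterSpace ℂ A) :=
  inferInstance

instance compactSpace_higsonCompactification : CompactSpace (HigsonCompactification M) :=
  compactSpace_characterSpace _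

lemma comap_toHigson_le_cocompact (p : HigsonCorona M) :
    comap (toHigson (X := M)) (𝓝 p.1) ≤ cocompact M := by
  intro s hs
  obtain ⟨K, hK, hKs⟩ := mem_cocompact.1 hs
  refine ⟨(toHigson '' K)ᶜ, (hK.image continuous_toHigson).isClosed.isOpen_compl.mem_nhds ?_, ?_⟩
  · rintro ⟨x, -, hx⟩
    exact p.2 ⟨x, hx⟩
  · intro x hx
    exact hKs fun hxK => hx (Set.mem_image_of_mem _ hxK)

lemma IsBoundaryValue.tendsto {f : M → ℂ} {g : C(HigsonCorona M, ℂ)} (h : IsBoundaryValue f g)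
    (p : HigsonCorona M) : Tendsto f (comap toHigson (𝓝 p.1)) (𝓝 (g p)) := by
  obtain ⟨F, hF, hFp⟩ := h
  have := (hFp p).2.tendsto.comp (tendsto_comap (f := toHigson (X := M)))
  rw [(hFp p).1] at this
  exact this.congr hF

instance neBot_comap_toHigson (p : HigsonCompactification M) :
    (comap (toHigson (X := M)) (𝓝 p)).NeBot :=
  comap_neBot_iff_frequently.2 (mem_closure_iff_frequently.1 (denseRange_toHigson M p))

lemma IsBoundaryValue.unique {f : M → ℂ} {g₁ g₂ : C(HigsonCorona M, ℂ)}
    (h₁ : IsBoundaryValue f g₁) (h₂ : IsBoundaryValue f g₂) : g₁ = g₂ :=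
  ContinuousMap.ext fun p => tendsto_nhds_unique (h₁.tendsto p) (h₂.tendsto p)

lemma IsBoundaryValue.add {f₁ f₂ : M → ℂ} {g₁ g₂ : C(HigsonCorona M, ℂ)}
    (h₁ : IsBoundaryValue f₁ g₁) (h₂ : IsBoundaryValue f₂ g₂) :
    IsBoundaryValue (f₁ + f₂) (g₁ + g₂) := by
  obtain ⟨F, hF, hFp⟩ := h₁
  obtain ⟨G, hG, hGp⟩ := h₂
  exact ⟨F + G, fun x => congrArg₂ (· + ·) (hF x) (hG x),
    fun p => ⟨congrArg₂ (· + ·) (hFp p).1 (hGp p).1, (hFp p).2.add (hGp p).2⟩⟩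

lemma IsBoundaryValue.mul {f₁ f₂ : M → ℂ} {g₁ g₂ : C(HigsonCorona M, ℂ)}
    (h₁ : IsBoundaryValue f₁ g₁) (h₂ : IsBoundaryValue f₂ g₂) :
    IsBoundaryValue (f₁ * f₂) (g₁ * g₂) := by
  obtain ⟨F, hF, hFp⟩ := h₁
  obtain ⟨G, hG, hGp⟩ := h₂
  exact ⟨F * G, fun x => congrArg₂ (· * ·) (hF x) (hG x),
    fun p => ⟨congrArg₂ (· * ·) (hFp p).1 (hGp p).1, (hFp p).2.mul (hGp p).2⟩⟩

variable (M) in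
lemma isBoundaryValue_const (c : ℂ) :
    IsBoundaryValue (algebraMap ℂ (M → ℂ) c) (algebraMap ℂ C(HigsonCorona M, ℂ) c) :=
  ⟨fun _ => c, fun _ => rfl, fun _ => ⟨rfl, continuousAt_const⟩⟩

lemma isBoundaryValue_contHigson (f : ContHigsonAlgebra M) : IsBoundaryValue f.1
    ⟨fun p : HigsonCorona M => p.1 f, (continuous_eval_higson f).comp continuous_subtype_val⟩ :=
  ⟨fun p => p f, fun _ => rfl, fun _ => ⟨rfl, (continuous_eval_higson f).continuousAt⟩⟩

lemma isBddFun_coe (f : BorelHigsonAlgebra M) : IsBddFun (f : M → ℂ) := f.2.1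

lemma vanishingVariation_coe (f : BorelHigsonAlgebra M) :
    VanishingVariation (f : M → ℂ) := f.2.2.2

variable [ProperCoarseMetricSpace M]

lemma exists_contHigsonAlgebra_bump {x : M} {t : Set M} (ht : IsClosed t) (hx : x ∉ t) :
    ∃ f : ContHigsonAlgebra M, f.1 x = 1 ∧ (∀ y ∈ t, f.1 y = 0) ∧
      Tendsto f.1 (cocompact M) (𝓝 0) := by
  obtain ⟨F, hF1, hF0, hFs, hF⟩ := exists_continuous_one_zero_of_isCompact
    (isCompact_singleton (x := x)) ht (Set.disjoint_singleton_left.2 hx)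
  have hlim : Tendsto (fun y => (F y : ℂ)) (cocompact M) (𝓝 0) := by
    refine tendsto_const_nhds.congr' ?_
    filter_upwards [hFs.isCompact.compl_mem_cocompact] with y hy
    rw [image_eq_zero_of_notMem_tsupport hy, Complex.ofReal_zero]
  refine ⟨⟨BoundedContinuousFunction.ofNormedAddCommGroup (fun y => (F y : ℂ))
    (Complex.continuous_ofReal.comp F.continuous) 1 fun y => ?_,
    VanishingVariation.of_tendsto_zero hlim⟩, ?_, fun y hy => ?_, hlim⟩
  · rw [Complex.norm_real, Real.norm_eq_abs, abs_of_nonneg (hF y).1]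
    exact (hF y).2
  · have h : F x = 1 := hF1 (Set.mem_singleton x)
    change (F x : ℂ) = 1
    rw [h, Complex.ofReal_one]
  · have h : F y = 0 := hF0 hy
    change (F y : ℂ) = 0
    rw [h, Complex.ofReal_zero]

lemma injective_toHigson : Function.Injective (toHigson (X := M)) := by
  intro x y hxy
  by_contra hne
  obtain ⟨f, hf1, hf0, -⟩ := exists_contHigsonAlgebra_bump (isClosed_singleton (x := y)) hne
  have h : f.1 x = f.1 y := DFunLike.congr_fun hxy f
  rw [hf1, hf0 y rfl] at h
  exact one_ne_zero h

/-- A point of the compactification that is the limit of a filter going to infinity is on the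
corona. -/
lemma notMem_range_toHigson {l : Filter M} [l.NeBot] (hl : l ≤ cocompact M)
    {p : HigsonCompactification M} (hp : Tendsto toHigson l (𝓝 p)) :
    p ∉ Set.range (toHigson (X := M)) := by
  rintro ⟨x, rfl⟩
  obtain ⟨f, hf1, -, hf0⟩ := exists_contHigsonAlgebra_bump isClosed_empty (Set.notMem_empty x)
  have h1 : Tendsto (fun y => f.1 y) l (𝓝 (f.1 x)) :=
    ((continuous_eval_higson f).tendsto (toHigson x)).comp hp
  have h2 := tendsto_nhds_unique h1 (hf0.mono_left hl)
  rw [hf1] at h2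
  exact one_ne_zero h2

variable (M) in
lemma isClosed_corona : IsClosed (Set.range (toHigson (X := M)))ᶜ := by
  refine isClosed_of_closure_subset fun p hp => ?_
  rintro ⟨x, rfl⟩
  obtain ⟨f, hf1, -, hf0⟩ := exists_contHigsonAlgebra_bump isClosed_empty (Set.notMem_empty x)
  -- `f` is `1` at `x` and tends to `0` at infinity, so that it vanishes on the corona
  have hsub : (Set.range (toHigson (X := M)))ᶜ ⊆ {q : HigsonCompactification M | q f = 0} := by
    intro q hq
    have h1 : Tendsto (fun y => f.1 y) (comap toHigson (𝓝 q)) (𝓝 (q f)) :=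
      ((continuous_eval_higson f).tendsto q).comp tendsto_comap
    exact tendsto_nhds_unique h1 (hf0.mono_left (comap_toHigson_le_cocompact ⟨q, hq⟩))
  have h2 : f.1 x = 0 :=
    closure_minimal hsub (isClosed_eq (continuous_eval_higson f) continuous_const) hp
  rw [hf1] at h2
  exact one_ne_zero h2

/-- The points of the corona are the limits of the filters going to infinity. -/
lemma exists_corona_tendsto (l : Ultrafilter M) (hl : (l : Filter M) ≤ cocompact M) :
    ∃ p : HigsonCorona M, Tendsto toHigson (l : Filter M) (𝓝 p.1) := by
  obtain ⟨p, -, hp⟩ := isCompact_univ.ultrafilter_le_nhds' (l.map toHigson) univ_mem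
  exact ⟨⟨p, notMem_range_toHigson hl hp⟩, hp⟩

lemma isBoundaryValue_of_tendsto_zero {f : M → ℂ} (hf : Tendsto f (cocompact M) (𝓝 0)) :
    IsBoundaryValue f 0 := by
  classical
  refine ⟨fun p => if h : ∃ x, toHigson x = p then f h.choose else 0, fun x => ?_, fun p => ?_⟩
  · have h : ∃ y, toHigson y = toHigson x := ⟨x, rfl⟩
    simp only [dif_pos h, injective_toHigson h.choose_spec]
  · have hp : ¬ ∃ x, toHigson x = p.1 := p.2
    refine ⟨dif_neg hp, ?_⟩
    rw [ContinuousAt, dif_neg hp, Metric.tendsto_nhds]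
    intro ε hε
    obtain ⟨K, hK, hKf⟩ := mem_cocompact.1 (Metric.tendsto_nhds.1 hf ε hε)
    have hopen := (hK.image continuous_toHigson).isClosed.isOpen_compl
    filter_upwards [hopen.mem_nhds fun ⟨x, _, hx⟩ => hp ⟨x, hx⟩] with q hq
    split_ifs with h
    · exact hKf fun hm => hq ⟨_, hm, h.choose_spec⟩
    · simpa using hε

/-- Up to functions vanishing at infinity, Higson functions are continuous: with `R` the diameter
of a cover, the balls about `f x` with radius the oscillation of `f` at scale `R` admit a continuous
selection. -/
lemma exists_contHigsonAlgebra_sub_tendsto {f : M → ℂ} (bf : IsBddFun f)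
    (hf : VanishingVariation f) :
    ∃ g : ContHigsonAlgebra M, Tendsto (fun x => f x - g.1 x) (cocompact M) (𝓝 0) := by
  have := sigmaCompactSpace_of_proper M
  obtain ⟨R, -, hU⟩ := exists_open_cdist_le M
  obtain ⟨C, hC⟩ := bf
  set E : Set (M × M) := {e | cdist e.1 e.2 ≤ R}
  have hE : IsControlled E := isControlled_iff.2 ⟨R, fun x y h => h⟩
  obtain ⟨g, hg⟩ := exists_continuous_forall_mem_convex_of_local_const
    (t := fun x => Metric.closedBall (f x) (expansion E f x))
    (fun x => convex_closedBall _ _) fun x => by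
      obtain ⟨U, hUo, hx, hUR⟩ := hU x
      refine ⟨f x, ?_⟩
      filter_upwards [hUo.mem_nhds hx] with y hy
      rw [Metric.mem_closedBall, dist_comm, dist_eq_norm]
      exact norm_sub_le_expansion hC (hUR y hy x hx)
  have hlim : Tendsto (fun x => f x - g x) (cocompact M) (𝓝 0) := by
    refine squeeze_zero_norm (fun x => ?_) (hf E hE)
    have := hg x
    rwa [Metric.mem_closedBall, dist_comm, dist_eq_norm] at this
  have hexp : ∀ x, expansion E f x ≤ C + C := fun x =>
    expansion_le (add_nonneg ((norm_nonneg _).trans (hC x)) ((norm_nonneg _).trans (hC x)))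
      fun y _ => (norm_sub_le _ _).trans (add_le_add (hC x) (hC y))
  have hgb : ∀ x, ‖g x‖ ≤ C + C + C := fun x => by
    have h1 := hg x
    rw [Metric.mem_closedBall, dist_eq_norm] at h1
    have h2 := norm_add_le (g x - f x) (f x)
    rw [sub_add_cancel] at h2
    linarith [hexp x, hC x]
  have hgv : VanishingVariation g := by
    have h1 := VanishingVariation.of_tendsto_zero (neg_zero (G := ℂ) ▸ hlim.neg)
    have h2 := hf.add h1 ⟨C, hC⟩ ⟨C + C, fun x => ?_⟩
    · convert h2 using 1
      funext x
      simp
    · rw [norm_neg, ← dist_eq_norm, dist_comm]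
      exact (hg x).trans (hexp x)
  exact ⟨⟨BoundedContinuousFunction.ofNormedAddCommGroup g g.continuous _ hgb, hgv⟩, hlim⟩

lemma exists_isBoundaryValue {f : M → ℂ} (bf : IsBddFun f) (hf : VanishingVariation f) :
    ∃ g, IsBoundaryValue f g := by
  obtain ⟨k, hk⟩ := exists_contHigsonAlgebra_sub_tendsto bf hf
  have h := (isBoundaryValue_of_tendsto_zero hk).add (isBoundaryValue_contHigson k)
  rw [show (fun x => f x - k.1 x) + k.1 = f from funext fun x => sub_add_cancel _ _] at h
  exact ⟨_, h⟩

variable (M) in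
/-- The canonical homomorphism `∂ : ℬ_ν(M) → C(νM)`, sending a function to its boundary value. -/
noncomputable def boundaryHom : BorelHigsonAlgebra M →ₐ[ℂ] C(HigsonCorona M, ℂ) :=
  have key : ∀ f : BorelHigsonAlgebra M,
      IsBoundaryValue (f : M → ℂ) (exists_isBoundaryValue (isBddFun_coe f) (vanishingVariation_coe f)).choose :=
    fun f => (exists_isBoundaryValue (isBddFun_coe f) (vanishingVariation_coe f)).choose_spec
  AlgHom.ofLinearMap
    { toFun := fun f => (exists_isBoundaryValue (isBddFun_coe f) (vanishingVariation_coe f)).choose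
      map_add' := fun f g => (key (f + g)).unique ((key f).add (key g))
      map_smul' := fun c f => by
        have h := (isBoundaryValue_const M c).mul (key f)
        rw [← Algebra.smul_def, ← Algebra.smul_def] at h
        exact (key (c • f)).unique h }
    ((key 1).unique (by simpa using! isBoundaryValue_const M 1))
    fun f g => (key (f * g)).unique ((key f).mul (key g))

lemma isBoundaryValue_boundaryHom (f : BorelHigsonAlgebra M) :
    IsBoundaryValue (f : M → ℂ) (boundaryHom M f) :=
  (exists_isBoundaryValue (isBddFun_coe f) (vanishingVariation_coe f)).choose_spec

lemma boundaryHom_eq_zero_iff {f : BorelHigsonAlgebra M} :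
    boundaryHom M f = 0 ↔ Tendsto (f : M → ℂ) (cocompact M) (𝓝 0) := by
  have hb := isBoundaryValue_boundaryHom f
  constructor
  · intro h
    rw [h] at hb
    refine (tendsto_iff_ultrafilter _ _ _).2 fun l hl => ?_
    obtain ⟨p, hp⟩ := exists_corona_tendsto l hl
    exact (hb.tendsto p).mono_left (tendsto_iff_comap.1 hp)
  · exact fun h => hb.unique (isBoundaryValue_of_tendsto_zero h)

lemma boundaryHom_eq_iff {f g : BorelHigsonAlgebra M} : boundaryHom M f = boundaryHom M g ↔
    Tendsto (fun x => (f : M → ℂ) x - (g : M → ℂ) x) (cocompact M) (𝓝 0) := by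
  rw [← sub_eq_zero, ← map_sub, boundaryHom_eq_zero_iff]
  rfl

variable (M) in
/-- Surjectivity of `∂`: functions on the corona, which is closed, extend by Tietze's theorem to the
compactification, where every continuous function is a Gelfand transform. -/
lemma surjective_boundaryHom : Function.Surjective (boundaryHom M) := by
  intro g
  obtain ⟨F, hF⟩ := ContinuousMap.exists_restrict_eq (isClosed_corona M) g
  obtain ⟨f, hf⟩ := exists_contHigsonAlgebra_eq F
  refine ⟨⟨f.1, ⟨‖f.1‖, f.1.norm_coe_le_norm⟩, ?_, f.2⟩, ?_⟩
  · let _ := borel M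
    have : BorelSpace M := ⟨rfl⟩
    exact f.1.continuous.measurable
  · refine (isBoundaryValue_boundaryHom _).unique ⟨fun p => p f, fun _ => rfl, fun p =>
      ⟨?_, (continuous_eval_higson f).continuousAt⟩⟩
    exact (hf p).trans (DFunLike.congr_fun hF p)

end Corona

/-! ### The homomorphism induced by a coarse equivalence -/

section Pullback

variable {M : Type u} [TopologicalSpace M] [CoarseMetric M]

lemma IsDiscretization.uniformlyExpansive {r : M → M} (hr : IsDiscretization r) :
    UniformlyExpansive r := by
  obtain ⟨K, hK⟩ := hr.exists_cdist_le
  intro R hR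
  refine ⟨max 1 (K + (R + K)), by positivity, fun x z hxz => le_max_of_le_right ?_⟩
  have h1 := cdist_triangle (r x) x (r z)
  have h2 := cdist_triangle x z (r z)
  have h3 := hK z
  rw [cdist_comm] at h3
  linarith [hK x]

lemma IsDiscretization.tendsto_sub {r : M → M} (hr : IsDiscretization r) {f : M → ℂ}
    (bf : IsBddFun f) (hf : VanishingVariation f) :
    Tendsto (fun x => f x - f (r x)) (cocompact M) (𝓝 0) := by
  obtain ⟨R, hR⟩ := hr.exists_cdist_le
  exact hf.tendsto_sub bf tendsto_id (R := R) fun x => by rw [cdist_comm]; exact hR x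

variable [ProperCoarseMetricSpace M] {M' : Type v} [TopologicalSpace M'] [CoarseMetric M'] [ProperCoarseMetricSpace M']

/-- The Borel Higson function `f ∘ r`, for an arbitrary Higson function `f` and a discretization
`r`. -/
def IsDiscretization.higson {r : M → M} (hr : IsDiscretization r) (f : M → ℂ) (bf : IsBddFun f)
    (hf : VanishingVariation f) : BorelHigsonAlgebra M :=
  ⟨f ∘ r, bf.imp fun _ h x => h (r x), fun s _ => hr.measurableSet_preimage (f ⁻¹' s),
    hf.comp bf hr.uniformlyExpansive hr.tendsto⟩

/-- The homomorphism `g ↦ g ∘ f ∘ r` between Higson algebras. The discretization `r` makes the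
values Borel, as `f` need not be. -/
def pullbackHom {r : M → M} (hr : IsDiscretization r) {f : M → M'} (hf : IsCoarseMap f) :
    BorelHigsonAlgebra M' →ₐ[ℂ] BorelHigsonAlgebra M where
  toFun g := hr.higson ((g : M' → ℂ) ∘ f) ((isBddFun_coe g).imp fun _ h x => h (f x))
    ((vanishingVariation_coe g).comp (isBddFun_coe g) hf.1 hf.2.tendsto)
  map_one' := rfl
  map_mul' _ _ := rfl
  map_zero' := rfl
  map_add' _ _ := rfl
  commutes' _ := rfl

lemma tendsto_pullbackHom {r : M → M} (hr : IsDiscretization r) {f : M → M'} (hf : IsCoarseMap f)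
    {g : BorelHigsonAlgebra M'} (hg : Tendsto (g : M' → ℂ) (cocompact M') (𝓝 0)) :
    Tendsto (pullbackHom hr hf g : M → ℂ) (cocompact M) (𝓝 0) :=
  hg.comp (hf.2.tendsto.comp hr.tendsto)

lemma boundaryHom_pullbackHom_pullbackHom {r : M → M} (hr : IsDiscretization r) {r' : M' → M'}
    (hr' : IsDiscretization r') {f : M → M'} (hf : IsCoarseMap f) {g : M' → M}
    (hg : IsCoarseMap g) (h : Close (g ∘ f) id) (k : BorelHigsonAlgebra M) :
    boundaryHom M (pullbackHom hr hf (pullbackHom hr' hg k)) = boundaryHom M k := by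
  obtain ⟨R, hR⟩ := hr.exists_cdist_le
  obtain ⟨R', hR'⟩ := hr'.exists_cdist_le
  obtain ⟨S, -, hS⟩ := hg.1 (max R' 1) (by positivity)
  obtain ⟨T, hT⟩ := h
  symm
  refine boundaryHom_eq_iff.2 ((vanishingVariation_coe k).tendsto_sub (isBddFun_coe k) tendsto_id
    (q := fun x => g (r' (f (r x)))) (R := S + (T + R)) fun x => ?_)
  have h1 := cdist_triangle (g (r' (f (r x)))) (g (f (r x))) x
  have h2 := cdist_triangle (g (f (r x))) (r x) x
  have h3 := hS _ _ ((hR' (f (r x))).trans (le_max_left _ _))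
  have h4 : cdist (g (f (r x))) (r x) ≤ T := hT (r x)
  rw [cdist_comm]
  change cdist (g (r' (f (r x)))) x ≤ _
  linarith [hR x]

lemma exists_algEquiv_of_surjective {R A B C : Type*} [CommRing R] [CommRing A] [CommRing B]
    [CommRing C] [Algebra R A] [Algebra R B] [Algebra R C] {p : A →ₐ[R] B} {q : A →ₐ[R] C}
    (hp : Function.Surjective p) (hq : Function.Surjective q) (h : ∀ a, p a = 0 ↔ q a = 0) :
    ∃ e : B ≃ₐ[R] C, ∀ a, e (p a) = q a := by
  have hker : RingHom.ker p = RingHom.ker q := Ideal.ext h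
  refine ⟨(Ideal.quotientKerAlgEquivOfSurjective hp).symm.trans
    ((Ideal.quotientEquivAlgOfEq R hker).trans (Ideal.quotientKerAlgEquivOfSurjective hq)),
    fun a => ?_⟩
  have : (Ideal.quotientKerAlgEquivOfSurjective hp).symm (p a) = Ideal.Quotient.mk _ a :=
    (AlgEquiv.symm_apply_eq _).2 rfl
  rw [AlgEquiv.trans_apply, this]
  rfl

lemma CoarseMetric.CoarselyEquivalent.exists_induces [Nonempty M] [Nonempty M']
    (h : CoarselyEquivalent M M') :
    ∃ (φ : BorelHigsonAlgebra M' →ₐ[ℂ] BorelHigsonAlgebra M)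
      (Φ : C(HigsonCorona M', ℂ) ≃ₐ[ℂ] C(HigsonCorona M, ℂ)), Induces φ Φ.toAlgHom := by
  obtain ⟨f, g, hf, hg, hfg, hgf⟩ := h
  obtain ⟨r, hr⟩ := exists_isDiscretization M
  obtain ⟨r', hr'⟩ := exists_isDiscretization M'
  obtain ⟨Φ, hΦ⟩ := exists_algEquiv_of_surjective (p := boundaryHom M')
    (q := (boundaryHom M).comp (pullbackHom hr hf)) (surjective_boundaryHom M')
    (fun b => by
      obtain ⟨k, rfl⟩ := surjective_boundaryHom M b
      exact ⟨pullbackHom hr' hg k, boundaryHom_pullbackHom_pullbackHom hr hr' hf hg hgf k⟩)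
    (fun k => by
      refine ⟨fun hk => ?_, fun hk => ?_⟩
      · exact boundaryHom_eq_zero_iff.2
          (tendsto_pullbackHom hr hf (boundaryHom_eq_zero_iff.1 hk))
      · rw [← boundaryHom_pullbackHom_pullbackHom hr' hr hg hf hfg]
        exact boundaryHom_eq_zero_iff.2
          (tendsto_pullbackHom hr' hg (boundaryHom_eq_zero_iff.1 hk)))
  refine ⟨pullbackHom hr hf, Φ, fun k => ⟨_, isBoundaryValue_boundaryHom k, ?_⟩⟩
  have := isBoundaryValue_boundaryHom (pullbackHom hr hf k)
  rw [← AlgHom.comp_apply, ← hΦ] at this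
  exact this

end Pullback

/-! ### Higson functions separating asymptotically disjoint sets -/

section Separation

variable {M : Type u} [CoarseMetric M]

/-- The distance from a point to a set; it is `0` if the set is empty. -/
noncomputable def cdistTo (A : Set M) (x : M) : ℝ := ⨅ a : A, cdist x a

lemma cdistTo_nonneg (A : Set M) (x : M) : 0 ≤ cdistTo A x :=
  Real.iInf_nonneg fun _ => cdist_nonneg _ _

lemma cdistTo_le {A : Set M} {a : M} (ha : a ∈ A) (x : M) : cdistTo A x ≤ cdist x a :=
  ciInf_le (f := fun a : A => cdist x a) ⟨0, by rintro _ ⟨b, rfl⟩; exact cdist_nonneg _ _⟩ ⟨a, ha⟩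

lemma exists_cdist_lt_cdistTo_add_one {A : Set M} (hA : A.Nonempty) (x : M) :
    ∃ a ∈ A, cdist x a < cdistTo A x + 1 := by
  have := hA.to_subtype
  obtain ⟨a, ha⟩ := exists_lt_of_ciInf_lt
    (show ⨅ a : A, cdist x a < cdistTo A x + 1 from lt_add_one _)
  exact ⟨a, a.2, ha⟩

lemma cdistTo_le_add {A : Set M} (hA : A.Nonempty) (x y : M) :
    cdistTo A x ≤ cdist x y + cdistTo A y := by
  have := hA.to_subtype
  rw [← sub_le_iff_le_add']
  refine le_ciInf fun a => ?_
  linarith [cdistTo_le a.2 x, cdist_triangle x y a]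

lemma abs_cdistTo_sub_le {A : Set M} (hA : A.Nonempty) (x y : M) :
    |cdistTo A x - cdistTo A y| ≤ cdist x y := by
  have h := cdistTo_le_add hA y x
  rw [cdist_comm] at h
  exact abs_sub_le_iff.2 ⟨by linarith [cdistTo_le_add hA x y], by linarith⟩

/-- Two sets are asymptotically disjoint if outside bounded sets they are arbitrarily far apart. -/
def AsympDisjoint (A B : Set M) : Prop :=
  ∀ R : ℝ, IsBdd {a | a ∈ A ∧ ∃ b ∈ B, cdist a b ≤ R}

/-- A function close to `1` on `A` and vanishing far away from `A` relative to the distance to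
`B`. -/
noncomputable def separator (A B : Set M) (x : M) : ℝ :=
  max 0 (1 - 4 * (cdistTo A x / (1 + (cdistTo A x + cdistTo B x))))

lemma separator_eq_zero {A B : Set M} {x : M} (h : 1 + cdistTo B x ≤ 3 * cdistTo A x) :
    separator A B x = 0 := by
  have h1 := cdistTo_nonneg A x
  have h2 := cdistTo_nonneg B x
  refine max_eq_left ?_
  rw [sub_nonpos, ← mul_div_assoc, le_div_iff₀ (by positivity)]
  linarith

lemma isBddFun_separator (A B : Set M) : IsBddFun fun x => (separator A B x : ℂ) := by
  refine ⟨1, fun x => ?_⟩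
  have h1 := cdistTo_nonneg A x
  have h2 := cdistTo_nonneg B x
  rw [Complex.norm_real, Real.norm_eq_abs, separator, abs_of_nonneg (le_max_left _ _)]
  have : 0 ≤ 4 * (cdistTo A x / (1 + (cdistTo A x + cdistTo B x))) := by positivity
  exact max_le zero_le_one (by linarith)

lemma abs_separator_sub_le {A B : Set M} (hA : A.Nonempty) (hB : B.Nonempty) (x y : M) :
    |separator A B x - separator A B y| ≤
      12 * cdist x y / (1 + (cdistTo A x + cdistTo B x)) := by
  rw [separator, separator, max_comm 0, max_comm 0]
  refine (abs_max_sub_max_le_abs _ _ _).trans ?_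
  have hx := cdistTo_nonneg A x
  have hx' := cdistTo_nonneg B x
  have hy := cdistTo_nonneg A y
  have hy' := cdistTo_nonneg B y
  have h1 := abs_le.1 (abs_cdistTo_sub_le hA x y)
  have h2 := abs_le.1 (abs_cdistTo_sub_le hB x y)
  have hd := cdist_nonneg x y
  set a := cdistTo A x
  set b := cdistTo B x
  set a' := cdistTo A y
  set b' := cdistTo B y
  set d := cdist x y
  have e : 1 - 4 * (a / (1 + (a + b))) - (1 - 4 * (a' / (1 + (a' + b')))) =
      4 * ((a' - a) * (1 + b') + a' * (b - b')) / ((1 + (a + b)) * (1 + (a' + b'))) := by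
    field_simp
    ring
  rw [e, abs_div, abs_of_pos (show 0 < (1 + (a + b)) * (1 + (a' + b')) by positivity),
    div_le_div_iff₀ (by positivity) (by positivity)]
  have h3 : |4 * ((a' - a) * (1 + b') + a' * (b - b'))| ≤ 12 * d * (1 + (a' + b')) := by
    have h4 : |(a' - a) * (1 + b')| ≤ d * (1 + b') := by
      rw [abs_mul, abs_of_nonneg (show 0 ≤ 1 + b' by positivity)]
      exact mul_le_mul_of_nonneg_right (abs_le.2 ⟨by linarith, by linarith⟩) (by positivity)
    have h5 : |a' * (b - b')| ≤ a' * d := by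
      rw [abs_mul, abs_of_nonneg hy]
      exact mul_le_mul_of_nonneg_left (abs_le.2 ⟨by linarith, by linarith⟩) hy
    have h6 := abs_add_le ((a' - a) * (1 + b')) (a' * (b - b'))
    have h7 : 0 ≤ d * b' := by positivity
    have h8 : 0 ≤ d * a' := by positivity
    rw [abs_mul, abs_of_nonneg (by norm_num : (0 : ℝ) ≤ 4)]
    linarith
  calc _ ≤ 12 * d * (1 + (a' + b')) * (1 + (a + b)) :=
        mul_le_mul_of_nonneg_right h3 (by positivity)
    _ = _ := by ring

variable [TopologicalSpace M] [ProperCoarseMetricSpace M]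

lemma AsympDisjoint.tendsto_atTop {A B : Set M} (h : AsympDisjoint A B) (hA : A.Nonempty)
    (hB : B.Nonempty) : Tendsto (fun x => cdistTo A x + cdistTo B x) (cocompact M) atTop := by
  refine Filter.tendsto_atTop.2 fun T => eventually_cocompact_iff.2 ?_
  refine ((h (2 * T + 2)).thickening (T + 1)).mono fun x hx => ?_
  have hx : cdistTo A x + cdistTo B x < T := not_le.1 hx
  obtain ⟨a, ha, hxa⟩ := exists_cdist_lt_cdistTo_add_one hA x
  obtain ⟨b, hb, hxb⟩ := exists_cdist_lt_cdistTo_add_one hB x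
  have h1 := cdistTo_nonneg A x
  have h2 := cdistTo_nonneg B x
  rw [cdist_comm] at hxa
  exact ⟨a, ⟨ha, b, hb, by linarith [cdist_triangle a x b]⟩, by linarith⟩

lemma AsympDisjoint.vanishingVariation_separator {A B : Set M} (h : AsympDisjoint A B)
    (hA : A.Nonempty) (hB : B.Nonempty) : VanishingVariation fun x => (separator A B x : ℂ) := by
  refine .of_eventually fun R ε hε => ?_
  filter_upwards [(h.tendsto_atTop hA hB).eventually_ge_atTop (12 * R / ε)] with x hx y hy
  have hx1 := cdistTo_nonneg A x
  have hx2 := cdistTo_nonneg B x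
  rw [← Complex.ofReal_sub, Complex.norm_real, Real.norm_eq_abs]
  refine (abs_separator_sub_le hA hB x y).trans ?_
  rw [div_le_iff₀ hε] at hx
  rw [div_le_iff₀ (by positivity)]
  nlinarith

lemma AsympDisjoint.tendsto_separator_one {A B : Set M} (h : AsympDisjoint A B)
    (hA : A.Nonempty) (hB : B.Nonempty) :
    Tendsto (fun x => (separator A B x : ℂ)) (cocompact M ⊓ 𝓟 A) (𝓝 1) := by
  obtain ⟨R₀, hR₀, h₀⟩ := exists_cdist_self_le M
  have h1 : Tendsto (fun x => R₀ / (1 + (cdistTo A x + cdistTo B x))) (cocompact M ⊓ 𝓟 A)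
      (𝓝 0) :=
    ((tendsto_atTop_add_const_left _ 1 (h.tendsto_atTop hA hB)).const_div_atTop R₀).mono_left
      inf_le_left
  have h2 : Tendsto (fun x => cdistTo A x / (1 + (cdistTo A x + cdistTo B x)))
      (cocompact M ⊓ 𝓟 A) (𝓝 0) := by
    refine squeeze_zero' (.of_forall fun x => ?_) ?_ h1
    · have := cdistTo_nonneg A x
      have := cdistTo_nonneg B x
      positivity
    · filter_upwards [mem_inf_of_right (mem_principal_self A)] with x hx
      have := cdistTo_nonneg A x
      have := cdistTo_nonneg B x
      exact div_le_div_of_nonneg_right ((cdistTo_le hx x).trans (h₀ x)) (by positivity)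
  have h3 : Tendsto (separator A B) (cocompact M ⊓ 𝓟 A) (𝓝 1) := by
    have := (tendsto_const_nhds (x := (0 : ℝ))).max ((h2.const_mul 4).const_sub 1)
    rwa [mul_zero, sub_zero, max_eq_right zero_le_one] at this
  exact (Complex.continuous_ofReal.tendsto 1).comp h3

lemma AsympDisjoint.tendsto_separator_zero {A B : Set M} (h : AsympDisjoint A B)
    (hA : A.Nonempty) (hB : B.Nonempty) :
    Tendsto (fun x => (separator A B x : ℂ)) (cocompact M ⊓ 𝓟 B) (𝓝 0) := by
  obtain ⟨R₀, hR₀, h₀⟩ := exists_cdist_self_le M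
  refine tendsto_const_nhds.congr' ?_
  filter_upwards [mem_inf_of_right (mem_principal_self B), mem_inf_of_left
    ((h.tendsto_atTop hA hB).eventually_ge_atTop (1 + 4 * R₀))] with x hx hs
  have h1 := (cdistTo_le hx x).trans (h₀ x)
  rw [separator_eq_zero (by linarith [cdistTo_nonneg A x, cdistTo_nonneg B x]),
    Complex.ofReal_zero]

lemma AsympDisjoint.exists_borelHigson [Nonempty M] {A B : Set M} (h : AsympDisjoint A B)
    (hA : A.Nonempty) (hB : B.Nonempty) :
    ∃ k : BorelHigsonAlgebra M, Tendsto (k : M → ℂ) (cocompact M ⊓ 𝓟 A) (𝓝 1) ∧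
      Tendsto (k : M → ℂ) (cocompact M ⊓ 𝓟 B) (𝓝 0) := by
  obtain ⟨r, hr⟩ := exists_isDiscretization M
  have bf := isBddFun_separator A B
  have hf := h.vanishingVariation_separator hA hB
  have hd := hr.tendsto_sub bf hf
  refine ⟨hr.higson _ bf hf, ?_, ?_⟩
  · have := (h.tendsto_separator_one hA hB).sub (hd.mono_left inf_le_left)
    rw [sub_zero] at this
    exact this.congr fun x => sub_sub_cancel _ _
  · have := (h.tendsto_separator_zero hA hB).sub (hd.mono_left inf_le_left)
    rw [sub_zero] at this
    exact this.congr fun x => sub_sub_cancel _ _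

lemma exists_subseq_lt_cdist {p q : ℕ → M} (hp : Tendsto p atTop (cocompact M))
    (hq : Tendsto q atTop (cocompact M)) :
    ∃ σ : ℕ → ℕ, StrictMono σ ∧ ∀ m n : ℕ, m < n →
      (m : ℝ) < cdist (p (σ m)) (q (σ n)) ∧ (m : ℝ) < cdist (q (σ m)) (p (σ n)) := by
  obtain ⟨σ, -, hσ⟩ := exists_seq_of_forall_finset_exists (fun _ : ℕ => True)
    (fun a b => a < b ∧ (a : ℝ) < cdist (p a) (q b) ∧ (a : ℝ) < cdist (q a) (p b)) fun s _ => by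
      have : ∀ᶠ b in atTop, ∀ a ∈ s,
          a < b ∧ (a : ℝ) < cdist (p a) (q b) ∧ (a : ℝ) < cdist (q a) (p b) := by
        refine (Filter.eventually_all_finset s).2 fun a _ => ?_
        exact (eventually_gt_atTop a).and
          ((((tendsto_cdist_cocompact (p a)).comp hq).eventually_gt_atTop (a : ℝ)).and
            (((tendsto_cdist_cocompact (q a)).comp hp).eventually_gt_atTop (a : ℝ)))
      obtain ⟨b, hb⟩ := this.exists
      exact ⟨b, trivial, hb⟩
  have hmono : StrictMono σ := fun m n hmn => (hσ m n hmn).1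
  refine ⟨σ, hmono, fun m n hmn => ?_⟩
  have h : (m : ℝ) ≤ σ m := Nat.cast_le.2 (hmono.le_apply)
  exact ⟨h.trans_lt (hσ m n hmn).2.1, h.trans_lt (hσ m n hmn).2.2⟩

omit [TopologicalSpace M] [ProperCoarseMetricSpace M] in
lemma asympDisjoint_image {p q : ℕ → M} {S T : Set ℕ}
    (h : ∀ n ∈ S, ∀ m ∈ T, ((min n m : ℕ) : ℝ) < cdist (p n) (q m)) :
    AsympDisjoint (p '' S) (q '' T) := by
  intro R
  obtain ⟨N, hN⟩ := exists_nat_ge R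
  refine ((((Set.finite_Iio N).image p).isBdd).union
    ((((Set.finite_Iio N).image q).isBdd).thickening R)).mono ?_
  rintro _ ⟨⟨n, hn, rfl⟩, _, ⟨m, hm, rfl⟩, hnm⟩
  have hlt : min n m < N := by exact_mod_cast ((h n hn m hm).trans_le hnm).trans_le hN
  rcases min_lt_iff.1 hlt with h | h
  · exact Or.inl ⟨n, h, rfl⟩
  · exact Or.inr ⟨q m, ⟨m, h, rfl⟩, by rwa [cdist_comm]⟩

/-- Sequences whose terms go to infinity and away from each other are asymptotically separated by a
Higson function, after passing to a subsequence. -/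
lemma exists_subseq_borelHigson {p q : ℕ → M} (hp : Tendsto p atTop (cocompact M))
    (hq : Tendsto q atTop (cocompact M)) (hpq : ∀ n : ℕ, (n : ℝ) < cdist (p n) (q n)) :
    ∃ (σ : ℕ → ℕ) (k : BorelHigsonAlgebra M), StrictMono σ ∧
      Tendsto (fun n => (k : M → ℂ) (p (σ n))) atTop (𝓝 1) ∧
      Tendsto (fun n => (k : M → ℂ) (q (σ n))) atTop (𝓝 0) := by
  have : Nonempty M := ⟨p 0⟩
  obtain ⟨σ, hσ, h⟩ := exists_subseq_lt_cdist hp hq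
  have hd : AsympDisjoint ((p ∘ σ) '' Set.univ) ((q ∘ σ) '' Set.univ) := by
    refine asympDisjoint_image fun n _ m _ => ?_
    rcases lt_trichotomy n m with hnm | rfl | hnm
    · rw [min_eq_left hnm.le]
      exact (h n m hnm).1
    · rw [min_self]
      exact (Nat.cast_le.2 hσ.le_apply).trans_lt (hpq (σ n))
    · rw [min_eq_right hnm.le, cdist_comm]
      exact (h m n hnm).2
  obtain ⟨k, hk1, hk0⟩ := hd.exists_borelHigson (Set.univ_nonempty.image _)
    (Set.univ_nonempty.image _)
  have hlim : ∀ {s : ℕ → M}, Tendsto s atTop (cocompact M) →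
      Tendsto (s ∘ σ) atTop (cocompact M ⊓ 𝓟 ((s ∘ σ) '' Set.univ)) := fun hs =>
    tendsto_inf.2 ⟨hs.comp hσ.tendsto_atTop,
      tendsto_principal.2 (.of_forall fun n => Set.mem_image_of_mem _ trivial)⟩
  exact ⟨σ, k, hσ, hk1.comp (hlim hp), hk0.comp (hlim hq)⟩

/-- For a sparse sequence, the separators of two almost disjoint sets of terms from their
complements have disjoint supports outside a bounded set. -/
lemma tendsto_separator_mul_separator {p : ℕ → M}
    (hp : ∀ m n : ℕ, m < n → (m : ℝ) < cdist (p m) (p n)) {S T : Set ℕ} (hS : S.Nonempty)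
    (hT : T.Nonempty) (hS' : Sᶜ.Nonempty) (hT' : Tᶜ.Nonempty) (hST : (S ∩ T).Finite) :
    Tendsto (fun x => separator (p '' S) (p '' Sᶜ) x * separator (p '' T) (p '' Tᶜ) x)
      (cocompact M) (𝓝 0) := by
  obtain ⟨s, hs⟩ := hS'
  obtain ⟨t, ht⟩ := hT'
  obtain ⟨C, hC⟩ := (hST.image fun n => cdist (p n) (p s)).bddAbove
  obtain ⟨D, hD⟩ := (hST.image fun n => cdist (p n) (p t)).bddAbove
  set F : Set ℕ := S ∩ T ∪ Set.Iio 4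
  have hF : F.Finite := hST.union (Set.finite_Iio 4)
  have hbdd := (hF.image p).isBdd.thickening (max 3 (max (2 + C) (2 + D)))
  refine tendsto_const_nhds.congr' (eventually_cocompact_iff.2 (hbdd.mono fun x hx => ?_))
  have hx : 0 ≠ separator (p '' S) (p '' Sᶜ) x * separator (p '' T) (p '' Tᶜ) x := hx
  have h1 : 3 * cdistTo (p '' S) x < 1 + cdistTo (p '' Sᶜ) x := by
    by_contra! h
    exact hx (by rw [separator_eq_zero h, zero_mul])
  have h2 : 3 * cdistTo (p '' T) x < 1 + cdistTo (p '' Tᶜ) x := by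
    by_contra! h
    exact hx (by rw [separator_eq_zero h, mul_zero])
  obtain ⟨_, ⟨n, hn, rfl⟩, hxn⟩ := exists_cdist_lt_cdistTo_add_one (hS.image p) x
  obtain ⟨_, ⟨m, hm, rfl⟩, hxm⟩ := exists_cdist_lt_cdistTo_add_one (hT.image p) x
  have h3 := cdistTo_nonneg (p '' S) x
  have h4 := cdistTo_nonneg (p '' T) x
  rw [Set.mem_ofPred_eq]
  by_cases hnT : n ∈ T
  · have h5 := cdistTo_le (Set.mem_image_of_mem p hs) x
    have h6 : cdist (p n) (p s) ≤ C := hC (Set.mem_image_of_mem _ ⟨hn, hnT⟩)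
    refine ⟨p n, Set.mem_image_of_mem p (Or.inl ⟨hn, hnT⟩), ?_⟩
    refine le_max_of_le_right (le_max_of_le_left ?_)
    rw [cdist_comm]
    linarith [cdist_triangle x (p n) (p s), cdist_nonneg (p n) (p s)]
  by_cases hmS : m ∈ S
  · have h5 := cdistTo_le (Set.mem_image_of_mem p ht) x
    have h6 : cdist (p m) (p t) ≤ D := hD (Set.mem_image_of_mem _ ⟨hmS, hm⟩)
    refine ⟨p m, Set.mem_image_of_mem p (Or.inl ⟨hmS, hm⟩), ?_⟩
    refine le_max_of_le_right (le_max_of_le_right ?_)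
    rw [cdist_comm]
    linarith [cdist_triangle x (p m) (p t), cdist_nonneg (p m) (p t)]
  -- the nearest terms in `S` and `T` are distinct and both close to `x`, so one has a small index
  have h5 := cdistTo_le (Set.mem_image_of_mem p (show m ∈ Sᶜ from hmS)) x
  have h6 := cdistTo_le (Set.mem_image_of_mem p (show n ∈ Tᶜ from hnT)) x
  have e1 := cdist_comm x (p n)
  have e2 := cdist_comm x (p m)
  rcases lt_trichotomy n m with h | rfl | h
  · have h7 := hp n m h
    have h8 : (n : ℝ) < (4 : ℕ) := by
      push_cast
      linarith [cdist_triangle (p n) x (p m)]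
    exact ⟨p n, Set.mem_image_of_mem p (Or.inr (Nat.cast_lt.1 h8)),
      le_max_of_le_left (by linarith)⟩
  · exact absurd hm hnT
  · have h7 := hp m n h
    have h8 : (m : ℝ) < (4 : ℕ) := by
      push_cast
      linarith [cdist_triangle (p m) x (p n)]
    exact ⟨p m, Set.mem_image_of_mem p (Or.inr (Nat.cast_lt.1 h8)),
      le_max_of_le_left (by linarith)⟩

/-- An almost disjoint family of infinite sets of integers with the cardinality of the continuum:
the branches of the binary tree, whose nodes are the finite lists of Booleans. -/
lemma exists_almost_disjoint_family : ∃ S : (ℕ → Bool) → Set ℕ, (∀ α, (S α).Infinite) ∧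
    ∀ α β, α ≠ β → (S α ∩ S β).Finite := by
  refine ⟨fun α => Set.range fun n => Encodable.encode ((List.range n).map α), fun α => ?_,
    fun α β hαβ => ?_⟩
  · refine Set.infinite_range_of_injective fun n m h => ?_
    simpa using congrArg List.length (Encodable.encode_injective h)
  · obtain ⟨i, hi⟩ := Function.ne_iff.1 hαβ
    refine ((Set.finite_Iic i).image fun n => Encodable.encode ((List.range n).map α)).subset ?_
    rintro _ ⟨⟨n, rfl⟩, m, hm⟩
    refine ⟨n, ?_, rfl⟩
    have hl := Encodable.encode_injective hm
    obtain rfl : m = n := by simpa using congrArg List.length hl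
    by_contra hlt
    exact hi ((List.map_inj_left.1 hl) i (List.mem_range.2 (not_le.1 hlt))).symm

end Separation

/-! ### Characters of the Higson algebra -/

section Characters

variable {M : Type u} [TopologicalSpace M] [CoarseMetric M]

/-- Characters of the Higson algebra are contractive, since functions bounded away from zero are
invertible. -/
lemma norm_character_le (χ : BorelHigsonAlgebra M →ₐ[ℂ] ℂ) {k : BorelHigsonAlgebra M} {ε : ℝ}
    (hk : ∀ x, ‖(k : M → ℂ) x‖ ≤ ε) : ‖χ k‖ ≤ ε := by
  by_contra! hlt
  set c := χ k
  set δ := ‖c‖ - ε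
  have hδ : 0 < δ := sub_pos.2 hlt
  have hlow : ∀ x, δ ≤ ‖(k : M → ℂ) x - c‖ := fun x => by
    have h1 := norm_sub_norm_le c ((k : M → ℂ) x)
    rw [norm_sub_rev] at h1
    have h2 := hk x
    change ‖c‖ - ε ≤ _
    linarith
  have hne : ∀ x, (k : M → ℂ) x - c ≠ 0 := fun x => norm_pos_iff.1 (hδ.trans_le (hlow x))
  have hinv : ∀ x, ‖((k : M → ℂ) x - c)⁻¹‖ ≤ δ⁻¹ := fun x => by
    rw [norm_inv]
    exact inv_anti₀ hδ (hlow x)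
  have hmeas : Measurable[borel M] fun x => ((k : M → ℂ) x - c)⁻¹ := by
    let _ := borel M
    have hm : Measurable (k : M → ℂ) := k.2.2.1
    exact (hm.sub_const c).inv
  have hvar : VanishingVariation fun x => ((k : M → ℂ) x - c)⁻¹ := by
    refine .of_eventually fun R η hη => ?_
    filter_upwards [(vanishingVariation_coe k).eventually (isBddFun_coe k) R
      (show 0 < η * (δ * δ) by positivity)] with x hx y hy
    rw [inv_sub_inv (hne x) (hne y), norm_div, norm_mul, div_le_iff₀
      (mul_pos (norm_pos_iff.2 (hne x)) (norm_pos_iff.2 (hne y))), sub_sub_sub_cancel_right,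
      norm_sub_rev]
    refine (hx y hy).trans (mul_le_mul_of_nonneg_left ?_ hη.le)
    exact mul_le_mul (hlow x) (hlow y) hδ.le (norm_nonneg _)
  set w : BorelHigsonAlgebra M := ⟨_, ⟨δ⁻¹, hinv⟩, hmeas, hvar⟩
  have hw : w * (k - algebraMap ℂ _ c) = 1 :=
    Subtype.ext (funext fun x => inv_mul_cancel₀ (hne x))
  have := congrArg χ hw
  rw [map_mul, map_sub, AlgHom.commutes, map_one, Algebra.algebraMap_self, RingHom.id_apply,
    sub_self, mul_zero] at this
  exact zero_ne_one this

/-- Evaluation at a point, as a character of the Higson algebra. -/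
noncomputable def evalHom (x : M) : BorelHigsonAlgebra M →ₐ[ℂ] ℂ :=
  (Pi.evalAlgHom ℂ (fun _ : M => ℂ) x).comp (BorelHigsonAlgebra M).val

variable [ProperCoarseMetricSpace M]

lemma tendsto_indicator_of_isBdd {s : Set M} (hs : IsBdd s) :
    Tendsto (s.indicator (1 : M → ℂ)) (cocompact M) (𝓝 0) :=
  tendsto_const_nhds.congr' (eventually_cocompact_iff.2 (hs.mono fun x hx => by
    by_contra h
    exact hx (Set.indicator_of_notMem h _).symm))

/-- The indicator function of a bounded Borel set. -/
noncomputable def indicatorHigson (s : Set M) (hm : MeasurableSet[borel M] s) (hs : IsBdd s) :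
    BorelHigsonAlgebra M :=
  ⟨s.indicator 1, ⟨1, fun x => by
      by_cases hx : x ∈ s
      · simp [hx]
      · simp [hx]⟩,
    by
      let _ := borel M
      exact measurable_one.indicator hm,
    .of_tendsto_zero (tendsto_indicator_of_isBdd hs)⟩

lemma IsDiscretization.isBdd_fiber {r : M → M} (hr : IsDiscretization r) (y : M) :
    IsBdd (r ⁻¹' {y}) :=
  metricallyProper_of_tendsto hr.tendsto _ (Set.finite_singleton y).isBdd

/-- The indicator function of a fiber of a discretization. -/
noncomputable def IsDiscretization.fiber {r : M → M} (hr : IsDiscretization r) (y : M) :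
    BorelHigsonAlgebra M :=
  indicatorHigson (r ⁻¹' {y}) (hr.measurableSet_preimage {y}) (hr.isBdd_fiber y)

lemma IsDiscretization.fiber_apply {r : M → M} (hr : IsDiscretization r) (y z : M)
    [Decidable (r z = y)] : (hr.fiber y : M → ℂ) z = if r z = y then 1 else 0 := by
  change (r ⁻¹' {y}).indicator (1 : M → ℂ) z = _
  split_ifs with h
  · exact Set.indicator_of_mem (s := r ⁻¹' {y}) h _
  · exact Set.indicator_of_notMem (s := r ⁻¹' {y}) h _

lemma IsDiscretization.higson_mul_fiber {r : M → M} (hr : IsDiscretization r) (f : M → ℂ)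
    (bf : IsBddFun f) (hf : VanishingVariation f) (y : M) :
    hr.higson f bf hf * hr.fiber y = f y • hr.fiber y := by
  classical
  refine Subtype.ext (funext fun z => ?_)
  change f (r z) * (hr.fiber y : M → ℂ) z = f y * (hr.fiber y : M → ℂ) z
  rw [hr.fiber_apply]
  split_ifs with h
  · rw [h]
  · rw [mul_zero, mul_zero]

lemma IsDiscretization.fiber_mul_self {r : M → M} (hr : IsDiscretization r) (y : M) :
    hr.fiber y * hr.fiber y = hr.fiber y := by
  classical
  refine Subtype.ext (funext fun z => ?_)
  change (hr.fiber y : M → ℂ) z * (hr.fiber y : M → ℂ) z = _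
  rw [hr.fiber_apply]
  split_ifs <;> simp

/-- A character sends the indicators of the fibers to idempotents. If none of them goes to `1`, then
the character vanishes on all functions that vanish at infinity. -/
lemma IsDiscretization.character_eq_zero {r : M → M} (hr : IsDiscretization r)
    (χ : BorelHigsonAlgebra M →ₐ[ℂ] ℂ) (hχ : ∀ y, χ (hr.fiber y) ≠ 1)
    {k : BorelHigsonAlgebra M} (hk : Tendsto (k : M → ℂ) (cocompact M) (𝓝 0)) : χ k = 0 := by
  classical
  have h0 : ∀ y, χ (hr.fiber y) = 0 := fun y => by
    have h := congrArg χ (hr.fiber_mul_self y)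
    rw [map_mul] at h
    by_contra h'
    exact hχ y (mul_left_cancel₀ h' (by rw [h, mul_one]))
  refine norm_le_zero_iff.1 (le_of_forall_pos_le_add fun ε hε => ?_)
  rw [zero_add]
  have hev : ∀ᶠ x in cocompact M, ‖(k : M → ℂ) x‖ ≤ ε :=
    (tendsto_zero_iff_norm_tendsto_zero.1 hk).eventually_le_const hε
  have hfin := hr.finite_image _ (eventually_cocompact_iff.1 hev)
  set e : BorelHigsonAlgebra M := ∑ y ∈ hfin.toFinset, hr.fiber y
  have he : χ e = 0 := by
    rw [map_sum]
    exact Finset.sum_eq_zero fun y _ => h0 y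
  have hex : ∀ z, (e : M → ℂ) z = if r z ∈ hfin.toFinset then 1 else 0 := fun z => by
    have : evalHom z e = ∑ y ∈ hfin.toFinset, evalHom z (hr.fiber y) := map_sum _ _ _
    change evalHom z e = _
    rw [this, ← Finset.sum_ite_eq hfin.toFinset (r z) fun _ => (1 : ℂ)]
    exact Finset.sum_congr rfl fun y _ => hr.fiber_apply y z
  -- `e` is `1` where `k` is large, so that `k` may be replaced by the small function `k - k * e`
  have hke : χ k = χ (k - k * e) := by rw [map_sub, map_mul, he, mul_zero, sub_zero]
  rw [hke]
  refine norm_character_le χ fun z => ?_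
  change ‖(k : M → ℂ) z - (k : M → ℂ) z * (e : M → ℂ) z‖ ≤ ε
  rw [hex]
  split_ifs with h
  · simpa using hε.le
  · rw [mul_zero, sub_zero]
    by_contra hz
    exact h (hfin.mem_toFinset.2 ⟨z, hz, rfl⟩)

end Characters

/-! ### The coarse equivalence given by a homomorphism -/

section Reverse

variable {M : Type u} [TopologicalSpace M] [CoarseMetric M] [ProperCoarseMetricSpace M]
  {M' : Type v} [TopologicalSpace M'] [CoarseMetric M'] [ProperCoarseMetricSpace M']

omit [ProperCoarseMetricSpace M'] in
lemma tendsto_cocompact_of_lt_cdist {p : ℕ → M} {x₀ : M} (h : ∀ n : ℕ, (n : ℝ) < cdist x₀ (p n)) :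
    Tendsto p atTop (cocompact M) := by
  refine tendsto_cocompact_iff_isBdd.2 fun B hB => ?_
  obtain ⟨R, hR⟩ := (isBdd_iff x₀).1 hB
  filter_upwards [tendsto_natCast_atTop_atTop.eventually_ge_atTop R] with n hn hnB
  exact absurd (h n) (not_lt.2 ((hR _ hnB).trans hn))

/-- The homomorphism of Higson algebras is bijective modulo functions vanishing at infinity. -/
structure IsCoronaIso (φ : BorelHigsonAlgebra M' →ₐ[ℂ] BorelHigsonAlgebra M) : Prop where
  eq_zero_iff : ∀ k, boundaryHom M (φ k) = 0 ↔ boundaryHom M' k = 0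
  exists_eq : ∀ h, ∃ k, boundaryHom M (φ k) = boundaryHom M h

lemma Induces.isCoronaIso {φ : BorelHigsonAlgebra M' →ₐ[ℂ] BorelHigsonAlgebra M}
    {Φ : C(HigsonCorona M', ℂ) ≃ₐ[ℂ] C(HigsonCorona M, ℂ)} (h : Induces φ Φ.toAlgHom) :
    IsCoronaIso φ := by
  have key : ∀ k, boundaryHom M (φ k) = Φ (boundaryHom M' k) := fun k => by
    obtain ⟨g, hg, hΦg⟩ := h k
    rw [(isBoundaryValue_boundaryHom k).unique hg]
    exact (isBoundaryValue_boundaryHom (φ k)).unique hΦg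
  refine ⟨fun k => by rw [key, map_eq_zero_iff Φ Φ.injective], fun h => ?_⟩
  obtain ⟨k, hk⟩ := surjective_boundaryHom M' (Φ.symm (boundaryHom M h))
  exact ⟨k, by rw [key, hk, AlgEquiv.apply_symm_apply]⟩

variable {φ : BorelHigsonAlgebra M' →ₐ[ℂ] BorelHigsonAlgebra M}

/-- Outside a bounded set, the characters `k ↦ φ k x` are detected by the fibers of a
discretization of `M'`. Otherwise there is a sparse sequence of points `x` whose characters vanish
on all functions vanishing at infinity. An uncountable almost disjoint family of subsequences gives
Higson functions on `M` whose products vanish at infinity; so do the products of the functions on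
`M'` that correspond to them, so that each `x` sees at most one of these. But each of them is seen
by some `x`. -/
lemma IsCoronaIso.isBdd_forall_fiber_ne_one (hφ : IsCoronaIso φ) {r' : M' → M'}
    (hr' : IsDiscretization r') : IsBdd {x | ∀ y, (φ (hr'.fiber y) : M → ℂ) x ≠ 1} := by
  classical
  by_contra hbad
  set D : Set M := {x | ∀ y, (φ (hr'.fiber y) : M → ℂ) x ≠ 1}
  have hne : D.Nonempty := by
    by_contra h
    rw [Set.not_nonempty_iff_eq_empty] at h
    exact hbad (h ▸ Set.finite_empty.isBdd)
  obtain ⟨x₀, -⟩ := hne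
  have : Nonempty M := ⟨x₀⟩
  obtain ⟨r, hr⟩ := exists_isDiscretization M
  rw [isBdd_iff x₀] at hbad
  push Not at hbad
  choose q hqD hq using fun n : ℕ => hbad n
  have hqlim := tendsto_cocompact_of_lt_cdist hq
  obtain ⟨σ, hσ, hsep⟩ := exists_subseq_lt_cdist hqlim hqlim
  set p := q ∘ σ
  have hplim : Tendsto p atTop (cocompact M) := hqlim.comp hσ.tendsto_atTop
  have hsep : ∀ m n : ℕ, m < n → (m : ℝ) < cdist (p m) (p n) := fun m n h => (hsep m n h).1
  obtain ⟨S, hSinf, hSfin⟩ := exists_almost_disjoint_family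
  have hSc : ∀ α, (S α)ᶜ.Nonempty := fun α => by
    by_contra h
    have hu : S α = Set.univ := Set.compl_empty_iff.1 (Set.not_nonempty_iff_eq_empty.1 h)
    have hne : (fun i => !(α i)) ≠ α := fun h => by simpa using congrFun h 0
    have := hSfin _ _ hne
    rw [hu, Set.inter_univ] at this
    exact hSinf _ this
  have hdisj : ∀ α, AsympDisjoint (p '' S α) (p '' (S α)ᶜ) := fun α => by
    refine asympDisjoint_image fun n hn m hm => ?_
    rcases lt_trichotomy n m with h | rfl | h
    · rw [min_eq_left h.le]
      exact hsep n m h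
    · exact absurd hn hm
    · rw [min_eq_right h.le, cdist_comm]
      exact hsep m n h
  have hv := fun α => (hdisj α).vanishingVariation_separator ((hSinf α).nonempty.image p)
    ((hSc α).image p)
  set h : (ℕ → Bool) → BorelHigsonAlgebra M := fun α =>
    hr.higson _ (isBddFun_separator (p '' S α) (p '' (S α)ᶜ)) (hv α)
  choose g hg using fun α => hφ.exists_eq (h α)
  -- the point `p n` sees at most one of the functions `g α`
  have hprod : ∀ α β, α ≠ β → ∀ n, (φ (g α) : M → ℂ) (p n) * (φ (g β) : M → ℂ) (p n) = 0 := by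
    intro α β hαβ n
    have h1 : Tendsto (h α * h β : M → ℂ) (cocompact M) (𝓝 0) := by
      have h2 := (tendsto_separator_mul_separator hsep (hSinf α).nonempty (hSinf β).nonempty
        (hSc α) (hSc β) (hSfin α β hαβ)).comp hr.tendsto
      exact ((Complex.continuous_ofReal.tendsto 0).comp h2).congr fun x => Complex.ofReal_mul _ _
    have h2 : boundaryHom M' (g α * g β) = 0 := by
      rw [← hφ.eq_zero_iff, map_mul, map_mul, hg, hg, ← map_mul]
      exact boundaryHom_eq_zero_iff.2 h1
    have h3 := hr'.character_eq_zero ((evalHom (p n)).comp φ) (hqD (σ n))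
      (boundaryHom_eq_zero_iff.1 h2)
    rw [map_mul] at h3
    exact h3
  -- each function `g α` is seen by some point `p n`
  have hseen : ∀ α, ∃ n, (φ (g α) : M → ℂ) (p n) ≠ 0 := fun α => by
    have hA : Tendsto p (atTop ⊓ 𝓟 (S α)) (cocompact M ⊓ 𝓟 (p '' S α)) :=
      hplim.inf (tendsto_principal_principal.2 fun n hn => Set.mem_image_of_mem p hn)
    have hl : (atTop ⊓ 𝓟 (S α) : Filter ℕ).NeBot := by
      rw [← Nat.cofinite_eq_atTop, Filter.cofinite_inf_principal_neBot_iff]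
      exact hSinf α
    have h1 := (((hdisj α).tendsto_separator_one ((hSinf α).nonempty.image p)
      ((hSc α).image p)).comp hA)
    have h2 := (hr.tendsto_sub (isBddFun_separator (p '' S α) (p '' (S α)ᶜ)) (hv α)).comp
      (hplim.mono_left (inf_le_left (b := 𝓟 (S α))))
    have h3 := (boundaryHom_eq_iff.1 (hg α)).comp (hplim.mono_left (inf_le_left (b := 𝓟 (S α))))
    have h4 : Tendsto (fun n => (φ (g α) : M → ℂ) (p n)) (atTop ⊓ 𝓟 (S α)) (𝓝 1) := by
      have := (h1.sub h2).add h3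
      rw [sub_zero, add_zero] at this
      refine this.congr fun n => ?_
      change (separator (p '' S α) (p '' (S α)ᶜ) (p n) : ℂ) -
        (separator (p '' S α) (p '' (S α)ᶜ) (p n) -
          separator (p '' S α) (p '' (S α)ᶜ) (r (p n))) +
        ((φ (g α) : M → ℂ) (p n) - separator (p '' S α) (p '' (S α)ᶜ) (r (p n))) = _
      ring
    exact (h4.eventually_ne one_ne_zero).exists
  choose n hn using hseen
  have hinj : Function.Injective n := fun α β hαβ => by
    by_contra hne
    have h1 := hn β
    rw [← hαβ] at h1
    exact mul_ne_zero (hn α) h1 (hprod α β hne (n α))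
  -- by Cantor's theorem there is no injection from the branches to the points
  exact Function.cantor_injective (fun s : Set ℕ => n fun i => decide (i ∈ s))
    (hinj.comp fun s t hst => Set.ext fun i => by simpa using congrFun hst i)

/-- Modulo functions vanishing at infinity, `φ` is the composition with a map `f`, which sends a
point `x` to the point `y` whose fiber detects the character at `x`. -/
lemma IsCoronaIso.exists_map (hφ : IsCoronaIso φ) [Nonempty M] [Nonempty M'] :
    ∃ f : M → M', (∀ B : Set M, IsBdd B → IsBdd (f '' B)) ∧ ∀ k : BorelHigsonAlgebra M',
      Tendsto (fun x => (φ k : M → ℂ) x - (k : M' → ℂ) (f x)) (cocompact M) (𝓝 0) := by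
  classical
  obtain ⟨r, hr⟩ := exists_isDiscretization M
  obtain ⟨r', hr'⟩ := exists_isDiscretization M'
  set f₀ : M → M' := fun x =>
    if h : ∃ y, (φ (hr'.fiber y) : M → ℂ) x = 1 then h.choose else Classical.arbitrary M'
  have hf₀ : ∀ k : BorelHigsonAlgebra M',
      Tendsto (fun x => (φ k : M → ℂ) x - (k : M' → ℂ) (f₀ x)) (cocompact M) (𝓝 0) := by
    intro k
    set k' := hr'.higson k (isBddFun_coe k) (vanishingVariation_coe k)
    have h1 : boundaryHom M' (k - k') = 0 := by
      rw [map_sub, sub_eq_zero]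
      exact boundaryHom_eq_iff.2 (hr'.tendsto_sub (isBddFun_coe k) (vanishingVariation_coe k))
    refine (boundaryHom_eq_zero_iff.1 ((hφ.eq_zero_iff _).2 h1)).congr' ?_
    refine eventually_cocompact_iff.2 ((hφ.isBdd_forall_fiber_ne_one hr').mono fun x hx => ?_)
    rw [Set.mem_ofPred_eq] at hx ⊢
    contrapose! hx
    have hy : (φ (hr'.fiber (f₀ x)) : M → ℂ) x = 1 := by
      simp only [f₀, dif_pos hx]
      exact hx.choose_spec
    have h2 := congrArg (fun b => (φ b : M → ℂ) x) (hr'.higson_mul_fiber k (isBddFun_coe k)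
      (vanishingVariation_coe k) (f₀ x))
    simp only [map_mul, map_smul] at h2
    change (φ k' : M → ℂ) x * (φ (hr'.fiber (f₀ x)) : M → ℂ) x =
      (k : M' → ℂ) (f₀ x) * (φ (hr'.fiber (f₀ x)) : M → ℂ) x at h2
    rw [hy, mul_one, mul_one] at h2
    rw [map_sub, ← h2]
    rfl
  -- `f₀` may be unbounded on a bounded set, unlike its composition with a discretization
  refine ⟨f₀ ∘ r, fun B hB => ?_, fun k => ?_⟩
  · rw [Set.image_comp]
    exact ((hr.finite_image B hB).image f₀).isBdd
  · have h1 := hr.tendsto_sub (isBddFun_coe (φ k)) (vanishingVariation_coe (φ k))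
    have h2 := h1.add ((hf₀ k).comp hr.tendsto)
    rw [add_zero] at h2
    exact h2.congr fun x => sub_add_sub_cancel _ _ _

lemma IsCoronaIso.coarselyEquivalent (hφ : IsCoronaIso φ) [Nonempty M] [Nonempty M'] :
    CoarselyEquivalent M M' := by
  obtain ⟨f, hfB, hf⟩ := hφ.exists_map
  -- `f` is proper: test against the indicator of a bounded set
  have hft : Tendsto f (cocompact M) (cocompact M') := by
    refine tendsto_cocompact_iff_isBdd.2 fun B hB => ?_
    have hK := ProperCoarseMetricSpace.isCompact_closure B hB
    have hm : MeasurableSet[borel M'] (closure B) := by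
      let _ := borel M'
      have : BorelSpace M' := ⟨rfl⟩
      exact isClosed_closure.measurableSet
    have h1 : Tendsto (indicatorHigson _ hm hK.isBdd : M' → ℂ) (cocompact M') (𝓝 0) :=
      tendsto_indicator_of_isBdd hK.isBdd
    have h2 := (boundaryHom_eq_zero_iff.1 ((hφ.eq_zero_iff _).2
      (boundaryHom_eq_zero_iff.2 h1))).sub (hf (indicatorHigson _ hm hK.isBdd))
    rw [sub_zero] at h2
    filter_upwards [h2.eventually_ne (zero_ne_one (α := ℂ))] with x hx hxB
    refine hx ?_
    rw [sub_sub_cancel]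
    exact Set.indicator_of_mem (subset_closure hxB) _
  have hlim : ∀ {p : ℕ → M} {c : ℂ} {k : BorelHigsonAlgebra M'}, Tendsto p atTop (cocompact M) →
      (Tendsto (fun n => (k : M' → ℂ) (f (p n))) atTop (𝓝 c) ↔
        Tendsto (fun n => (φ k : M → ℂ) (p n)) atTop (𝓝 c)) := by
    intro p c k hp
    have h := (hf k).comp hp
    constructor
    · intro h1
      have := h.add h1
      rw [zero_add] at this
      exact this.congr fun n => sub_add_cancel _ _
    · intro h1
      have := h1.sub h
      rw [sub_zero] at this
      exact this.congr fun n => sub_sub_cancel _ _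
  -- `f` is uniformly expansive: otherwise a Higson function on `M'` separates the images of nearby
  -- points of `M`
  have hexp : UniformlyExpansive f := by
    intro R hR
    by_contra! hcon
    choose p q hpq hfpq using fun n : ℕ => hcon (n + 1) (by positivity)
    have hp : Tendsto p atTop (cocompact M) := by
      refine tendsto_cocompact_iff_isBdd.2 fun B hB => ?_
      obtain ⟨T, hT⟩ := isBdd_iff_forall.1 (hfB _ (hB.union (hB.thickening R)))
      filter_upwards [tendsto_natCast_atTop_atTop.eventually_ge_atTop T] with n hn hnB
      have h1 := hT _ (Set.mem_image_of_mem f (Or.inl hnB)) _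
        (Set.mem_image_of_mem f (Or.inr ⟨_, hnB, hpq n⟩))
      linarith [hfpq n]
    have hq := hp.cocompact_of_cdist_le hpq
    obtain ⟨σ, k, hσ, hk1, hk0⟩ := exists_subseq_borelHigson (hft.comp hp) (hft.comp hq)
      fun n => (lt_add_one (n : ℝ)).trans (hfpq n)
    have h1 := (hlim (hp.comp hσ.tendsto_atTop)).1 hk1
    have h0 := (hlim (hq.comp hσ.tendsto_atTop)).1 hk0
    have h2 := (vanishingVariation_coe (φ k)).tendsto_sub (isBddFun_coe (φ k))
      (hp.comp hσ.tendsto_atTop) (q := q ∘ σ) fun n => hpq (σ n)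
    have h3 := tendsto_nhds_unique h2 (h1.sub h0)
    simp at h3
  -- points of `M` with nearby images are near each other: otherwise a Higson function on `M`
  -- separates them, and by surjectivity it comes from `M'`
  have heff : ∀ R : ℝ, ∃ S : ℝ, ∀ x z, cdist (f x) (f z) ≤ R → cdist x z ≤ S := by
    intro R
    by_contra! hcon
    choose p q hfpq hpq using fun n : ℕ => hcon n
    have hclaim : ∀ p q : ℕ → M, (∀ n, cdist (f (p n)) (f (q n)) ≤ R) →
        (∀ n : ℕ, (n : ℝ) < cdist (p n) (q n)) → Tendsto p atTop (cocompact M) := by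
      intro p q hfpq hpq
      refine tendsto_cocompact_iff_isBdd.2 fun B hB => ?_
      obtain ⟨T, hT⟩ := isBdd_iff_forall.1
        (hB.union (metricallyProper_of_tendsto hft _ ((hfB B hB).thickening R)))
      filter_upwards [tendsto_natCast_atTop_atTop.eventually_ge_atTop T] with n hn hnB
      have h1 := hT (p n) (Or.inl hnB) (q n) (Or.inr ⟨_, Set.mem_image_of_mem f hnB, hfpq n⟩)
      linarith [hpq n]
    have hp := hclaim p q hfpq hpq
    have hq := hclaim q p (fun n => by rw [cdist_comm]; exact hfpq n)
      (fun n => by rw [cdist_comm]; exact hpq n)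
    obtain ⟨σ, h, hσ, hh1, hh0⟩ := exists_subseq_borelHigson hp hq hpq
    obtain ⟨k, hk⟩ := hφ.exists_eq h
    have hk := boundaryHom_eq_iff.1 hk
    have hp' := hp.comp hσ.tendsto_atTop
    have hq' := hq.comp hσ.tendsto_atTop
    have h1 : Tendsto (fun n => (φ k : M → ℂ) (p (σ n))) atTop (𝓝 1) := by
      have := (hk.comp hp').add hh1
      rw [zero_add] at this
      exact this.congr fun n => sub_add_cancel _ _
    have h0 : Tendsto (fun n => (φ k : M → ℂ) (q (σ n))) atTop (𝓝 0) := by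
      have := (hk.comp hq').add hh0
      rw [zero_add] at this
      exact this.congr fun n => sub_add_cancel _ _
    have h2 := (vanishingVariation_coe k).tendsto_sub (isBddFun_coe k) (hft.comp hp')
      (q := fun n => f (q (σ n))) fun n => hfpq (σ n)
    have h3 := tendsto_nhds_unique h2 (((hlim hp').2 h1).sub ((hlim hq').2 h0))
    simp at h3
  -- the image of `f` is a net: otherwise a Higson function not vanishing at infinity vanishes
  -- asymptotically on it, against injectivity
  have hnet : ∃ K : ℝ, ∀ y, ∃ x, cdist (f x) y ≤ K := by
    by_contra! hcon
    choose y hy using fun n : ℕ => hcon n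
    have hylim : Tendsto y atTop (cocompact M') :=
      tendsto_cocompact_of_lt_cdist fun n => hy n (Classical.arbitrary M)
    have hd : AsympDisjoint (Set.range y) (Set.range f) := by
      intro R
      obtain ⟨N, hN⟩ := exists_nat_ge R
      refine ((Set.finite_Iio N).image y).isBdd.mono ?_
      rintro _ ⟨⟨n, rfl⟩, _, ⟨x, rfl⟩, hnx⟩
      rw [cdist_comm] at hnx
      exact ⟨n, Nat.cast_lt.1 (((hy n x).trans_le hnx).trans_le hN), rfl⟩
    obtain ⟨k, hk1, hk0⟩ := hd.exists_borelHigson (Set.range_nonempty y) (Set.range_nonempty f)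
    have h1 : Tendsto (φ k : M → ℂ) (cocompact M) (𝓝 0) := by
      have := (hf k).add (hk0.comp (tendsto_inf.2
        ⟨hft, tendsto_principal.2 (.of_forall fun x => Set.mem_range_self x)⟩))
      rw [add_zero] at this
      exact this.congr fun n => sub_add_cancel _ _
    have h2 := boundaryHom_eq_zero_iff.1
      ((hφ.eq_zero_iff k).1 (boundaryHom_eq_zero_iff.2 h1))
    have h3 := tendsto_nhds_unique (h2.comp hylim) (hk1.comp (tendsto_inf.2
      ⟨hylim, tendsto_principal.2 (.of_forall fun n => Set.mem_range_self n)⟩))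
    exact zero_ne_one h3
  obtain ⟨K, hK⟩ := hnet
  choose g hg using hK
  refine coarselyEquivalent_of_uniformlyExpansive hexp (g := g) (fun R hR => ?_) ⟨K, hg⟩ ?_
  · obtain ⟨S, hS⟩ := heff (K + (R + K))
    refine ⟨max S 1, by positivity, fun y z hyz => le_max_of_le_left (hS _ _ ?_)⟩
    have h1 := cdist_triangle (f (g y)) y (f (g z))
    have h2 := cdist_triangle y z (f (g z))
    rw [cdist_comm z] at h2
    linarith [hg y, hg z]
  · obtain ⟨S, hS⟩ := heff K
    exact ⟨S, fun x => hS _ _ (hg (f x))⟩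

end Reverse

/-! ### The characterizations -/

theorem theorem1p4
    (M : Type u) [TopologicalSpace M] [CoarseMetric M] [ProperCoarseMetricSpace M] [Nonempty M]
    (M' : Type v) [TopologicalSpace M'] [CoarseMetric M'] [ProperCoarseMetricSpace M']
    [Nonempty M'] :
    (CoarselyEquivalent M M' ↔
      ∃ (φ : BorelHigsonAlgebra M' →ₐ[ℂ] BorelHigsonAlgebra M)
        (Φ : C(HigsonCorona M', ℂ) ≃ₐ[ℂ] C(HigsonCorona M, ℂ)), Induces φ Φ.toAlgHom) ∧
    (CoarselyQuasiConvex M → CoarselyQuasiConvex M' →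
      ((∃ (φ : BorelHigsonAlgebra M' →ₐ[ℂ] BorelHigsonAlgebra M)
        (Φ : C(HigsonCorona M', ℂ) ≃ₐ[ℂ] C(HigsonCorona M, ℂ)), Induces φ Φ.toAlgHom) ↔
        CoarselyQuasiIsometric M M')) := by
  have key : (∃ (φ : BorelHigsonAlgebra M' →ₐ[ℂ] BorelHigsonAlgebra M)
      (Φ : C(HigsonCorona M', ℂ) ≃ₐ[ℂ] C(HigsonCorona M, ℂ)), Induces φ Φ.toAlgHom) ↔
      CoarselyEquivalent M M' :=
    ⟨fun ⟨_, _, h⟩ => h.isCoronaIso.coarselyEquivalent, fun h => h.exists_induces⟩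
  exact ⟨key.symm, fun hM hM' =>
    key.trans ⟨fun h => h.coarselyQuasiIsometric hM hM', fun h => h.coarselyEquivalent⟩⟩
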